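/- Let $M\subset\mathbb R^3$ be a compact surface without boundary (not necessarily connected), embedded and of class $C^2$ (for instance smooth). The medial axis of $M$ is the closure of the set of points of $\mathbb R^3$ that have at least two nearest points on $M$. For $p\in M$, the local feature size $\mathrm{lfs}(p)$ is the distance from $p$ to the medial axis, and the empty ball size $\mathrm{ebs}(p)$ is the radius of the smallest medial ball tangent to $M$ at $p$, that is, of the smallest ball whose centre lies on the medial axis, whose interior is disjoint from $M$ and whose boundary contains $p$. Let $f_1,f_2$ be two nondegenerate triangles all of whose vertices lie on $M$, and for $j=1,2$ let $v_j$ be a chosen vertex of $f_j$, $\phi_j$ the plane angle of $f_j$ at $v_j$, $R_j$ the circumradius of $f_j$ and $N_j\neq0$ a vector normal to $f_j$. Put $\delta=|v_1v_2|/\mathrm{lfs}(v_1)$ and suppose $\delta<\sqrt{4\sqrt5-8}$. Let $$\beta=\arccos\Big(1-\frac{\delta^2}{2\sqrt{1-\delta^2}}\Big)+\sum_{j=1}^{2}\arcsin\Big(\frac{R_j}{\mathrm{ebs}(v_j)}\max\big(\cot\tfrac{\phi_j}{2},1\big)\Big),$$ where $\arcsin(x)$ is read as $\pi/2$ when $x>1$.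 Then: (1) the angle between $N_1$ and $N_2$ as unoriented directions, $\arccos\dfrac{|\langle N_1,N_2\rangle|}{\|N_1\|\,\|N_2\|}$, is at most $\beta$; (2) if $\nu$ is a continuous unit normal field on $M$ (for instance the outward one) and $N_1,N_2$ are directed so that $\langle N_j,\nu(v_j)\rangle\ge0$ for $j=1,2$, then the angle $\angle(N_1,N_2)\in[0,\pi]$ between the vectors is at most $\beta$. -/

import Mathlib

open scoped RealInnerProductSpace

noncomputable section

namespace AngleBound

/-- Euclidean three-space. -/
abbrev E3 : Type := EuclideanSpace ℝ (Fin 3)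

/-- `f` is a `C²` function near `p` that cuts out `M` as a regular zero set near `p`. -/
def IsLocalDefiningFunction (M : Set E3) (p : E3) (f : E3 → ℝ) : Prop :=
  ∃ U : Set E3, IsOpen U ∧ p ∈ U ∧ ContDiffOn ℝ 2 f U ∧ fderiv ℝ f p ≠ 0 ∧
    M ∩ U = {x ∈ U | f x = 0}

/-- A closed (compact, without boundary, not necessarily connected) surface of class `C²`
embedded in `ℝ³`: near each of its points it is a regular zero set. -/
structure IsClosedSurface (M : Set E3) : Prop where
  isClosed : IsClosed M
  isBounded : Bornology.IsBounded M
  exists_defining : ∀ p ∈ M, ∃ f : E3 → ℝ, IsLocalDefiningFunction M p f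

/-- `n` is a normal vector (possibly zero) of the surface `M` at `p`: a multiple of the gradient
at `p` of a local defining function. -/
def IsNormalVector (M : Set E3) (p n : E3) : Prop :=
  ∃ f : E3 → ℝ, IsLocalDefiningFunction M p f ∧ ∃ c : ℝ, n = c • gradient f p

/-- A continuous choice of unit normals along `M`, such as the outward-directed unit normals. -/
structure IsUnitNormalField (M : Set E3) (ν : E3 → E3) : Prop where
  continuousOn : ContinuousOn ν M
  isNormal : ∀ p ∈ M, IsNormalVector M p (ν p)
  norm_eq_one : ∀ p ∈ M, ‖ν p‖ = 1

/-- The medial axis: the closure of the set of points with at least two nearest points on `M`. -/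
def medialAxis (M : Set E3) : Set E3 :=
  closure {x | ∃ y ∈ M, ∃ z ∈ M, y ≠ z ∧
    dist x y = Metric.infDist x M ∧ dist x z = Metric.infDist x M}

/-- The local feature size: the distance from `p` to the medial axis of `M`. -/
def lfs (M : Set E3) (p : E3) : ℝ :=
  Metric.infDist p (medialAxis M)

/-- The ball with centre `c` and radius `r` is a medial ball tangent to `M` at the point `p` of `M`:
its centre is on the medial axis, its interior misses `M` and its boundary passes through `p`. -/
def IsMedialBallAt (M : Set E3) (p c : E3) (r : ℝ) : Prop :=
  c ∈ medialAxis M ∧ Disjoint (Metric.ball c r) M ∧ p ∈ Metric.sphere c r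

/-- The empty ball size: the radius of the smallest medial ball tangent to `M` at `p`. -/
def ebs (M : Set E3) (p : E3) : ℝ :=
  sInf {r : ℝ | ∃ c : E3, IsMedialBallAt M p c r}

/-- The plane angle of the triangle `T` at its vertex number `i`. -/
def planeAngle (T : Affine.Triangle ℝ E3) (i : Fin 3) : ℝ :=
  EuclideanGeometry.angle (T.points (i + 1)) (T.points i) (T.points (i + 2))

/-- `N` is a (nonzero) normal vector of the face `T`. -/
def IsFaceNormal (T : Affine.Triangle ℝ E3) (N : E3) : Prop :=
  N ≠ 0 ∧ ∀ w ∈ (affineSpan ℝ (Set.range T.points)).direction, ⟪w, N⟫ = 0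

/-- The angle in `[0, π/2]` between the lines spanned by two nonzero vectors, whose cosine is the
absolute value of the cosine of the angle between the vectors. -/
def lineAngle (x y : E3) : ℝ :=
  Real.arccos (|⟪x, y⟫| / (‖x‖ * ‖y‖))

/-- The term `arcsin ((R / ebs(v)) * max (cot (φ / 2)) 1)` for the face `T` and its vertex `v`
number `i`. (`Real.arcsin` takes the value `π / 2` at arguments above `1`.) -/
def faceTerm (M : Set E3) (T : Affine.Triangle ℝ E3) (i : Fin 3) : ℝ :=
  Real.arcsin (T.circumradius / ebs M (T.points i) * max (Real.cot (planeAngle T i / 2)) 1)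

end AngleBound

end

namespace AngleBound

open Set Filter Topology Metric

/-! The angle between the face normals is at most the sum of three angles: from each face normal to
the surface normal at its chosen vertex, and between the two surface normals.

Face to surface: up to radius `ebs`, balls tangent at a vertex v contain no surface point inside, so
every z in `M` satisfies 2 ebs(v) |⟨n, z - v⟩| ≤ |z - v|². Applied to the two edges at v, this
bounds the component of the unit normal n in the plane of the face, whose length is the sine of the
angle sought. The Gram identity, the law of cosines and the law of sines turn it into `faceTerm`
(`lineAngle_le_faceTerm`).

Surface to surface: let p, q be the two vertices and r ≤ lfs(p). The open ball B(p, r) misses the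
medial axis, so normal segments inside it carry empty tangent balls. At p take the two tangent balls
of radius r, and at q the two whose centres are where the normal line of q meets the sphere about p
of radius r. Balls on opposite sides of `M` cannot overlap (`add_le_dist_of_opposite`). The two
resulting distance inequalities add up to the bound on the cosine (`cos_bound_of_tangent_balls`).

"Side" means the sign of ⟨x - proj x, W x⟩ for a continuous field W of normals at the projected
points. A given field ν supplies W = ν ∘ proj; for unoriented directions W is built over a ball by
transporting a normal along radii (`exists_isNormalLift`). -/

/-! ### Nearest points and projection off the medial axis -/

/-- `y` is a point of `M` nearest to `x`. -/
def IsNearestPoint (M : Set E3) (x y : E3) : Prop :=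
  y ∈ M ∧ ∀ z ∈ M, dist x y ≤ dist x z

theorem IsNearestPoint.dist_eq {M : Set E3} {x y : E3} (h : IsNearestPoint M x y) :
    dist x y = infDist x M :=
  le_antisymm ((le_infDist ⟨y, h.1⟩).2 fun z hz => h.2 z hz) (infDist_le_dist_of_mem h.1)

theorem exists_isNearestPoint {M : Set E3} (hM : IsCompact M) (hne : M.Nonempty) (x : E3) :
    ∃ y, IsNearestPoint M x y := by
  obtain ⟨y, hy, h⟩ := hM.exists_infDist_eq_dist hne x
  exact ⟨y, hy, fun z hz => h ▸ infDist_le_dist_of_mem hz⟩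

theorem isNearestPoint_iff_disjoint_ball {M : Set E3} {x y : E3} (hy : y ∈ M) :
    IsNearestPoint M x y ↔ Disjoint (ball x (dist x y)) M := by
  rw [Set.disjoint_right]
  refine ⟨fun h z hz hzb => ?_, fun h => ⟨hy, fun z hz => ?_⟩⟩
  · rw [mem_ball, dist_comm] at hzb
    exact absurd (h.2 z hz) (not_le.2 hzb)
  · have := h hz
    rw [mem_ball, dist_comm z x, not_lt] at this
    exact this

theorem IsNearestPoint.unique {M : Set E3} {x y z : E3} (hx : x ∉ medialAxis M)
    (hy : IsNearestPoint M x y) (hz : IsNearestPoint M x z) : y = z := by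
  by_contra hne
  exact hx (subset_closure ⟨y, hy.1, z, hz.1, hne, hy.dist_eq, hz.dist_eq⟩)

theorem IsNearestPoint.add_smul_of_le {M : Set E3} {y v : E3} {s t : ℝ}
    (h : IsNearestPoint M (y + s • v) y) (ht : 0 ≤ t) (hts : t ≤ s) :
    IsNearestPoint M (y + t • v) y := by
  refine ⟨h.1, fun z hz => ?_⟩
  have h1 := h.2 z hz
  have h2 : dist (y + s • v) z ≤ dist (y + s • v) (y + t • v) + dist (y + t • v) z :=
    dist_triangle _ _ _
  rw [dist_add_left, dist_eq_norm (s • v), ← sub_smul, norm_smul, Real.norm_of_nonneg (sub_nonneg.2 hts)]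
    at h2
  rw [dist_self_add_left, norm_smul, Real.norm_of_nonneg (ht.trans hts)] at h1
  rw [dist_self_add_left, norm_smul, Real.norm_of_nonneg ht]
  linarith

theorem isNearestPoint_self {M : Set E3} {y : E3} (hy : y ∈ M) : IsNearestPoint M y y :=
  ⟨hy, fun z _ => by rw [dist_self]; exact dist_nonneg⟩

open Classical in
/-- A choice of a nearest point of `M`. -/
noncomputable def proj (M : Set E3) (x : E3) : E3 :=
  if h : ∃ y, IsNearestPoint M x y then h.choose else x

theorem isNearestPoint_proj {M : Set E3} (hM : IsCompact M) (hne : M.Nonempty) (x : E3) :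
    IsNearestPoint M x (proj M x) := by
  have h := exists_isNearestPoint hM hne x
  rw [proj, dif_pos h]
  exact h.choose_spec

theorem proj_eq {M : Set E3} {x y : E3} (hx : x ∉ medialAxis M) (hy : IsNearestPoint M x y) :
    proj M x = y := by
  have h : ∃ y, IsNearestPoint M x y := ⟨y, hy⟩
  rw [proj, dif_pos h]
  exact h.choose_spec.unique hx hy

/-- The part of `M` outside a neighbourhood of the projection is compact and, by uniqueness,
strictly farther from `x` than `M` is. This strict inequality persists near `x`. -/
theorem continuousAt_proj {M : Set E3} (hM : IsCompact M) (hne : M.Nonempty) {x : E3}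
    (hx : x ∉ medialAxis M) : ContinuousAt (proj M) x := by
  rw [ContinuousAt, tendsto_def]
  intro V hV
  obtain ⟨V', hV'V, hV'o, hxV'⟩ := _root_.mem_nhds_iff.1 hV
  refine Filter.mem_of_superset ?_ (preimage_mono hV'V)
  rcases (M \ V').eq_empty_or_nonempty with he | hne'
  · exact Filter.Eventually.of_forall fun z =>
      sdiff_eq_empty.1 he (isNearestPoint_proj hM hne z).1
  have hK : IsCompact (M \ V') := hM.diff hV'o
  have hlt : infDist x M < infDist x (M \ V') := by
    obtain ⟨y, hy, hxy⟩ := hK.exists_infDist_eq_dist hne' x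
    rw [hxy]
    refine lt_of_le_of_ne (infDist_le_dist_of_mem hy.1) fun h => hy.2 ?_
    have : IsNearestPoint M x y := ⟨hy.1, fun z hz => h ▸ infDist_le_dist_of_mem hz⟩
    rwa [← proj_eq hx this]
  have hev : ∀ᶠ z in 𝓝 x, infDist z M < infDist z (M \ V') :=
    (continuous_infDist_pt M).continuousAt.eventually_lt
      (continuous_infDist_pt _).continuousAt hlt
  filter_upwards [hev] with z hz
  by_contra hzV
  have h := isNearestPoint_proj hM hne z
  have := infDist_le_dist_of_mem (x := z) (show proj M z ∈ M \ V' from ⟨h.1, hzV⟩)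
  rw [h.dist_eq] at this
  exact absurd hz (not_lt.2 this)

/-- Moving away from the unique nearest point increases the distance to `M`. -/
theorem eventually_infDist_lt {M : Set E3} (hM : IsCompact M) (hne : M.Nonempty) {x v : E3}
    (hx : x ∉ medialAxis M) (hv : 0 < ⟪v, x - proj M x⟫) :
    ∀ᶠ s in 𝓝[>] (0 : ℝ), infDist x M < infDist (x + s • v) M := by
  have hc : ContinuousAt (fun s : ℝ => ⟪v, x - proj M (x + s • v)⟫) 0 := by
    have h1 : ContinuousAt (fun s : ℝ => proj M (x + s • v)) 0 := by
      have h0 : ContinuousAt (proj M) (x + (0 : ℝ) • v) := by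
        simpa using continuousAt_proj hM hne hx
      exact h0.comp (f := fun s : ℝ => x + s • v) (by fun_prop)
    fun_prop
  have hpos : ∀ᶠ s in 𝓝 (0 : ℝ), 0 < ⟪v, x - proj M (x + s • v)⟫ :=
    hc.eventually_const_lt (by simpa using hv)
  filter_upwards [nhdsWithin_le_nhds hpos, self_mem_nhdsWithin] with s hs hs0
  have hs0 : 0 < s := hs0
  have hn := isNearestPoint_proj hM hne (x + s • v)
  set y := proj M (x + s • v)
  -- The nearest point `y` of the moved point also serves as competitor for `x`: since ⟨v, x - y⟩ >
  -- 0, the move lengthens the distance to `y`.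
  rw [← hn.dist_eq]
  refine (infDist_le_dist_of_mem hn.1).trans_lt ?_
  rw [dist_eq_norm, dist_eq_norm]
  refine lt_of_pow_lt_pow_left₀ 2 (norm_nonneg _) ?_
  have : x + s • v - y = (x - y) + s • v := by abel
  rw [this, norm_add_sq_real, real_inner_comm, inner_smul_left]
  simp only [conj_trivial]
  have : 0 < s * ⟪v, x - y⟫ := mul_pos hs0 hs
  have : 0 ≤ ‖s • v‖ ^ 2 := by positivity
  linarith

/-- Away from the medial axis, a segment to the nearest point extends beyond its far end. -/
theorem IsNearestPoint.exists_extension {M : Set E3} (hM : IsCompact M) {c y : E3}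
    (hc : c ∉ medialAxis M) (hy : IsNearestPoint M c y) (hcy : c ≠ y) :
    ∃ ε > (0 : ℝ), IsNearestPoint M (c + ε • (c - y)) y := by
  have hne : M.Nonempty := ⟨y, hy.1⟩
  have hopen : IsOpen (medialAxis M)ᶜ := isClosed_closure.isOpen_compl
  obtain ⟨ε₁, hε₁, hball⟩ := Metric.nhds_basis_closedBall.mem_iff.1 (hopen.mem_nhds hc)
  have hd : 0 < dist c y := dist_pos.2 hcy
  obtain ⟨ε, hε, hεlt⟩ : ∃ ε > 0, ε ≤ ε₁ ∧ ε < dist c y :=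
    ⟨min ε₁ (dist c y / 2), by positivity, min_le_left _ _,
      (min_le_right _ _).trans_lt (by linarith)⟩
  -- Maximise the distance to `M` over a small ball about `c`. At the maximiser `x` no
  -- distance-increasing direction may stay in the ball, which forces `x - c` to be parallel to `x -
  -- proj M x`; then `c` lies on the segment from `x` to its projection.
  obtain ⟨x, hxB, hmax⟩ := (isCompact_closedBall c ε).exists_isMaxOn
    ⟨c, mem_closedBall_self hε.le⟩ (continuous_infDist_pt M).continuousOn
  have hxm : x ∉ medialAxis M := hball (closedBall_subset_closedBall hεlt.1 hxB)
  have hnx := isNearestPoint_proj hM hne x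
  set w := x - proj M x with hw
  set h := x - c with hh
  have hwd : dist c y ≤ ‖w‖ := by
    rw [hy.dist_eq, hw, ← dist_eq_norm, hnx.dist_eq]
    exact hmax (mem_closedBall_self hε.le)
  have hw0 : 0 < ‖w‖ := hd.trans_le hwd
  have hhle : ‖h‖ ≤ ε := by rw [hh, ← dist_eq_norm]; exact hxB
  have key : ∀ v : E3, 0 < ⟪v, w⟫ → ¬ ∀ᶠ s in 𝓝[>] (0 : ℝ), x + s • v ∈ closedBall c ε := by
    intro v hv hev
    obtain ⟨s, hs1, hs2⟩ := ((eventually_infDist_lt hM hne hxm hv).and hev).exists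
    exact absurd (hmax hs2) (not_le.2 hs1)
  have hhε : ‖h‖ = ε := by
    refine le_antisymm hhle (not_lt.1 fun hlt => key w ?_ ?_)
    · rw [real_inner_self_eq_norm_sq]; positivity
    · have hcont : ContinuousAt (fun s : ℝ => x + s • w) 0 := by fun_prop
      have : ball c ε ∈ 𝓝 (x + (0 : ℝ) • w) := by
        simpa using isOpen_ball.mem_nhds (show x ∈ ball c ε by
          rw [mem_ball, dist_eq_norm]; exact hlt)
      exact nhdsWithin_le_nhds ((hcont.eventually this).mono fun s hs => ball_subset_closedBall hs)
  have hh0 : 0 < ‖h‖ := hhε ▸ hε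
  have hpar : ⟪h, w⟫ = ‖h‖ * ‖w‖ := by
    refine le_antisymm (real_inner_le_norm _ _) (not_lt.1 fun hlt => ?_)
    -- If the directions differed, this difference of unit vectors would increase the distance to
    -- `M` and point into the ball.
    set v := ‖w‖⁻¹ • w - ‖h‖⁻¹ • h with hvdef
    have hq : ⟪h, w⟫ / (‖h‖ * ‖w‖) < 1 := (div_lt_one (by positivity)).2 hlt
    have hvw : ⟪v, w⟫ = ‖w‖ * (1 - ⟪h, w⟫ / (‖h‖ * ‖w‖)) := by
      rw [hvdef, inner_sub_left, inner_smul_left, inner_smul_left, real_inner_self_eq_norm_sq]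
      simp only [conj_trivial]
      field_simp
    have hvh : ⟪h, v⟫ = -(‖h‖ * (1 - ⟪h, w⟫ / (‖h‖ * ‖w‖))) := by
      rw [hvdef, inner_sub_right, inner_smul_right, inner_smul_right, real_inner_self_eq_norm_sq]
      field_simp
      ring
    refine key v (by rw [hvw]; exact mul_pos hw0 (by linarith)) ?_
    have hneg : ⟪h, v⟫ < 0 := by
      rw [hvh]; exact neg_neg_of_pos (mul_pos hh0 (by linarith))
    have hcont : ContinuousAt (fun s : ℝ => 2 * ⟪h, v⟫ + s * ‖v‖ ^ 2) 0 := by fun_prop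
    have hev : ∀ᶠ s in 𝓝 (0 : ℝ), 2 * ⟪h, v⟫ + s * ‖v‖ ^ 2 < 0 :=
      hcont.eventually_lt_const (by linarith)
    filter_upwards [nhdsWithin_le_nhds hev, self_mem_nhdsWithin] with s hs hs0
    have hs0 : 0 < s := hs0
    rw [mem_closedBall, dist_eq_norm]
    refine le_of_sq_le_sq ?_ hε.le
    have : x + s • v - c = h + s • v := by rw [hh]; abel
    rw [this, norm_add_sq_real, inner_smul_right, norm_smul, Real.norm_of_nonneg hs0.le, hhε]
    nlinarith
  have hsm : ‖w‖ • h = ‖h‖ • w := inner_eq_norm_mul_iff_real.1 hpar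
  set κ := ‖h‖ / ‖w‖ with hκ
  have hκ0 : 0 < κ := by positivity
  have hκ1 : κ < 1 := (div_lt_one hw0).2 (by rw [hhε]; exact hεlt.2.trans_le hwd)
  have hhw : h = κ • w := by
    rw [hκ, div_eq_inv_mul, mul_smul, ← hsm, smul_smul, inv_mul_cancel₀ hw0.ne', one_smul]
  have hx1 : x = proj M x + (1 : ℝ) • w := by rw [hw]; module
  have hcw : c = proj M x + (1 - κ) • w := by
    have : c = x - h := by rw [hh]; abel
    rw [this, hhw, hw]; module
  rw [hx1] at hnx
  have hpy : proj M x = y := by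
    have h1 := hnx
    rw [← hx1] at h1
    have h2 : IsNearestPoint M (proj M x + (1 : ℝ) • w) (proj M x) := by rwa [← hx1]
    have h3 := h2.add_smul_of_le (t := 1 - κ) (by linarith) (by linarith)
    rw [← hcw] at h3
    exact h3.unique hc hy
  refine ⟨κ / (1 - κ), div_pos hκ0 (by linarith), ?_⟩
  have h1κ : (1 - κ) ≠ 0 := by linarith
  have hcy' : c - y = (1 - κ) • w := by rw [← hpy]; nth_rw 1 [hcw]; abel
  have : c + (κ / (1 - κ)) • (c - y) = x := by
    rw [hcy', smul_smul, div_mul_cancel₀ _ h1κ, ← hhw, hh]; abel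
  rw [this, ← hpy]
  exact isNearestPoint_proj hM hne x

/-! ### Defining functions, Lagrange multipliers and normal vectors -/

namespace IsLocalDefiningFunction

variable {M : Set E3} {p : E3} {f : E3 → ℝ}

theorem contDiffAt (h : IsLocalDefiningFunction M p f) : ContDiffAt ℝ 2 f p := by
  obtain ⟨U, hU, hpU, hf, -, -⟩ := h
  exact hf.contDiffAt (hU.mem_nhds hpU)

theorem eventually_mem_iff (h : IsLocalDefiningFunction M p f) :
    ∀ᶠ x in 𝓝 p, x ∈ M ↔ f x = 0 := by
  obtain ⟨U, hU, hpU, -, -, hMU⟩ := h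
  filter_upwards [hU.mem_nhds hpU] with x hx
  have : x ∈ M ∩ U ↔ x ∈ {x ∈ U | f x = 0} := by rw [hMU]
  simpa [hx] using this

theorem gradient_ne_zero (h : IsLocalDefiningFunction M p f) : gradient f p ≠ 0 := by
  obtain ⟨U, hU, hpU, -, hf, -⟩ := h
  simpa [gradient] using hf

theorem continuousAt_fderiv (h : IsLocalDefiningFunction M p f) :
    ContinuousAt (fderiv ℝ f) p :=
  (h.contDiffAt.fderiv_right (m := 1) (by norm_num)).continuousAt

theorem continuousAt_gradient (h : IsLocalDefiningFunction M p f) :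
    ContinuousAt (gradient f) p :=
  (InnerProductSpace.toDual ℝ E3).symm.continuous.continuousAt.comp h.continuousAt_fderiv

theorem eventually (h : IsLocalDefiningFunction M p f) :
    ∀ᶠ y in 𝓝 p, IsLocalDefiningFunction M y f := by
  have hne : ∀ᶠ y in 𝓝 p, fderiv ℝ f y ≠ 0 := by
    obtain ⟨U, hU, hpU, -, hf, -⟩ := id h
    exact h.continuousAt_fderiv.eventually_ne hf
  obtain ⟨U, hU, hpU, hf, -, hMU⟩ := h
  filter_upwards [hU.mem_nhds hpU, hne] with y hy hy'
  exact ⟨U, hU, hy, hf, hy', hMU⟩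

theorem inner_gradient (f : E3 → ℝ) (p v : E3) : ⟪gradient f p, v⟫ = fderiv ℝ f p v := by
  simp [gradient]

/-- Lagrange multipliers on `M`. -/
theorem exists_eq_smul_gradient_of_isLocalExtrOn (h : IsLocalDefiningFunction M p f)
    (hp : p ∈ M) {φ : E3 → ℝ} {g : E3} (hφ : IsLocalExtrOn φ M p)
    (hg : HasStrictFDerivAt φ (innerSL ℝ g) p) : ∃ c : ℝ, g = c • gradient f p := by
  have hf0 : f p = 0 := h.eventually_mem_iff.self_of_nhds.1 hp
  have hset : 𝓝[{x | f x = f p}] p = 𝓝[M] p := by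
    rw [nhdsWithin_eq_iff_eventuallyEq]
    filter_upwards [h.eventually_mem_iff] with x hx
    rw [hf0]
    exact propext hx.symm
  have hφ' : IsLocalExtrOn φ {x | f x = f p} p := by
    rw [IsLocalExtrOn, hset]; exact hφ
  obtain ⟨a, b, hab, heq⟩ := hφ'.exists_multipliers_of_hasStrictFDerivAt_1d
    (h.contDiffAt.hasStrictFDerivAt (by norm_num)) hg
  have heq' : a • gradient f p + b • g = 0 := by
    refine ext_inner_right ℝ fun v => ?_
    have := congrArg (fun L => L v) heq
    simpa [inner_add_left, inner_smul_left, inner_gradient] using this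
  have hb : b ≠ 0 := by
    rintro rfl
    rw [zero_smul, add_zero, smul_eq_zero] at heq'
    rcases heq' with ha | hgr
    · exact hab (by rw [ha]; rfl)
    · exact h.gradient_ne_zero hgr
  refine ⟨-(b⁻¹ * a), ?_⟩
  have : b • g = -(a • gradient f p) := by rw [eq_neg_iff_add_eq_zero, add_comm]; exact heq'
  rw [neg_smul, mul_smul, ← smul_neg, ← this, smul_smul, inv_mul_cancel₀ hb, one_smul]

theorem exists_eq_smul_gradient_of_isNearestPoint (h : IsLocalDefiningFunction M p f) {x : E3}
    (hx : IsNearestPoint M x p) : ∃ c : ℝ, x - p = c • gradient f p := by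
  have hg : HasStrictFDerivAt (fun z => ‖z - x‖ ^ 2) (innerSL ℝ ((2 : ℝ) • (p - x))) p := by
    have h1 := (hasStrictFDerivAt_norm_sq (p - x)).comp p
      ((hasStrictFDerivAt_id p).sub_const x)
    refine h1.congr_fderiv ?_
    ext v
    simp
  have hmin : IsLocalMinOn (fun z => ‖z - x‖ ^ 2) M p := by
    filter_upwards [self_mem_nhdsWithin] with z hz
    have := hx.2 z hz
    rw [dist_comm, dist_comm x, dist_eq_norm, dist_eq_norm] at this
    gcongr
  obtain ⟨c, hc⟩ := h.exists_eq_smul_gradient_of_isLocalExtrOn hx.1 hmin.isExtr hg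
  refine ⟨-(c / 2), ?_⟩
  rw [neg_smul, div_eq_inv_mul, mul_smul, ← hc, smul_smul]
  norm_num

/-- Any other defining function is constant on `M` near `p`, hence extremal there, so Lagrange
multipliers make the two gradients parallel: the normal line is well defined. -/
theorem exists_eq_smul_gradient_of_isNormalVector (h : IsLocalDefiningFunction M p f)
    (hp : p ∈ M) {n : E3} (hn : IsNormalVector M p n) : ∃ c : ℝ, n = c • gradient f p := by
  obtain ⟨g, hg, c, rfl⟩ := hn
  have hext : IsLocalExtrOn g M p := by
    refine IsMinFilter.isExtr ?_
    filter_upwards [nhdsWithin_le_nhds hg.eventually_mem_iff, self_mem_nhdsWithin] with z hz hzM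
    rw [hz.1 hzM, hg.eventually_mem_iff.self_of_nhds.1 hp]
  have hd : HasStrictFDerivAt g (innerSL ℝ (gradient g p)) p := by
    refine (hg.contDiffAt.hasStrictFDerivAt (by norm_num)).congr_fderiv ?_
    ext v
    simp
  obtain ⟨c', hc'⟩ := h.exists_eq_smul_gradient_of_isLocalExtrOn hp hext hd
  exact ⟨c * c', by rw [mul_smul, ← hc']⟩

/-- Near `p`, the surface deviates from its tangent planes at most quadratically. -/
theorem exists_quadratic_bound (h : IsLocalDefiningFunction M p f) :
    ∃ K > 0, ∃ r > 0, ∀ y ∈ M ∩ ball p r, ∀ z ∈ M ∩ ball p r,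
      |⟪gradient f y, z - y⟫| ≤ K * ‖z - y‖ ^ 2 := by
  obtain ⟨K, t, ht, hK⟩ :=
    (h.contDiffAt.fderiv_right (m := 1) (by norm_num)).exists_lipschitzOnWith
  have hdiff : ∀ᶠ x in 𝓝 p, DifferentiableAt ℝ f x :=
    (h.contDiffAt.eventually (by simp)).mono fun x hx => hx.differentiableAt (by norm_num)
  obtain ⟨r, hr, hsub⟩ := Metric.mem_nhds_iff.1 (inter_mem ht
    (inter_mem hdiff h.eventually_mem_iff))
  refine ⟨K + 1, by positivity, r, hr, fun y hy z hz => ?_⟩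
  have hseg : segment ℝ y z ⊆ ball p r := (convex_ball p r).segment_subset hy.2 hz.2
  -- Mean value inequality for `f` minus its linear part at `y`; both values of `f` vanish, so only
  -- the linear term remains.
  have hmv := (convex_segment y z).norm_image_sub_le_of_norm_fderiv_le' (𝕜 := ℝ) (f := f)
    (φ := fderiv ℝ f y) (C := K * ‖z - y‖) (fun x hx => (hsub (hseg hx)).2.1) (fun x hx => by
      refine (hK.norm_sub_le (hsub (hseg hx)).1 (hsub hy.2).1).trans ?_
      gcongr
      obtain ⟨θ, ⟨hθ0, hθ1⟩, rfl⟩ := (segment_eq_image' ℝ y z) ▸ hx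
      rw [add_sub_cancel_left, norm_smul, Real.norm_of_nonneg hθ0]
      exact mul_le_of_le_one_left (norm_nonneg _) hθ1)
    (left_mem_segment ℝ y z) (right_mem_segment ℝ y z)
  rw [(hsub hy.2).2.2.1 hy.1, (hsub hz.2).2.2.1 hz.1] at hmv
  rw [inner_gradient]
  simp only [sub_self, zero_sub, norm_neg, Real.norm_eq_abs] at hmv
  nlinarith [sq_nonneg ‖z - y‖]

end IsLocalDefiningFunction

theorem IsNormalVector.smul {M : Set E3} {p n : E3} (h : IsNormalVector M p n) (a : ℝ) :
    IsNormalVector M p (a • n) := by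
  obtain ⟨f, hf, c, rfl⟩ := h
  exact ⟨f, hf, a * c, by rw [mul_smul]⟩

theorem IsNormalVector.exists_eq_smul {M : Set E3} {p n m : E3} (hp : p ∈ M)
    (hn : IsNormalVector M p n) (hn0 : n ≠ 0) (hm : IsNormalVector M p m) :
    ∃ c : ℝ, m = c • n := by
  obtain ⟨f, hf, c, rfl⟩ := hn
  have hc : c ≠ 0 := fun h => hn0 (by rw [h, zero_smul])
  obtain ⟨d, rfl⟩ := hf.exists_eq_smul_gradient_of_isNormalVector hp hm
  exact ⟨d / c, by rw [smul_smul, div_mul_cancel₀ _ hc]⟩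

/-! ### The surface stays away from its medial axis -/

namespace IsClosedSurface

variable {M : Set E3}

theorem isCompact (hM : IsClosedSurface M) : IsCompact M :=
  Metric.isCompact_of_isClosed_isBounded hM.isClosed hM.isBounded

theorem exists_unit_normal (hM : IsClosedSurface M) {p : E3} (hp : p ∈ M) :
    ∃ n, IsNormalVector M p n ∧ ‖n‖ = 1 := by
  obtain ⟨f, hf⟩ := hM.exists_defining p hp
  exact ⟨_, ⟨f, hf, ‖gradient f p‖⁻¹, rfl⟩, norm_smul_inv_norm hf.gradient_ne_zero⟩

theorem isNormalVector_sub (hM : IsClosedSurface M) {x y : E3} (h : IsNearestPoint M x y) :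
    IsNormalVector M y (x - y) := by
  obtain ⟨f, hf⟩ := hM.exists_defining y h.1
  obtain ⟨c, hc⟩ := hf.exists_eq_smul_gradient_of_isNearestPoint h
  exact ⟨f, hf, c, hc⟩

/-- A closed surface is disjoint from its medial axis. -/
theorem notMem_medialAxis (hM : IsClosedSurface M) {p : E3} (hp : p ∈ M) :
    p ∉ medialAxis M := by
  obtain ⟨f, hf⟩ := hM.exists_defining p hp
  obtain ⟨K, hK, r, hr, hquad⟩ := hf.exists_quadratic_bound
  set m := ‖gradient f p‖ / 2 with hm
  have hg0 : 0 < ‖gradient f p‖ := norm_pos_iff.2 hf.gradient_ne_zero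
  have hm0 : 0 < m := by positivity
  have hgm : ∀ᶠ y in 𝓝 p, m < ‖gradient f y‖ :=
    hf.continuousAt_gradient.norm.eventually_const_lt (by rw [hm]; linarith)
  obtain ⟨r', hr', hsub⟩ := Metric.mem_nhds_iff.1 (inter_mem hf.eventually hgm)
  obtain ⟨ρ, hρ, hρr, hρr', hρK⟩ : ∃ ρ > 0, 2 * ρ ≤ r ∧ 2 * ρ ≤ r' ∧ 2 * K * ρ ≤ m / 2 := by
    refine ⟨min (min (r / 2) (r' / 2)) (m / (4 * K)), by positivity, ?_, ?_, ?_⟩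
    · linarith [(min_le_left (min (r / 2) (r' / 2)) (m / (4 * K))).trans (min_le_left _ _)]
    · linarith [(min_le_left (min (r / 2) (r' / 2)) (m / (4 * K))).trans (min_le_right _ _)]
    · have := min_le_right (min (r / 2) (r' / 2)) (m / (4 * K))
      rw [le_div_iff₀ (by positivity)] at this
      linarith
  rw [medialAxis, Metric.mem_closure_iff]
  push Not
  refine ⟨ρ, hρ, ?_⟩
  rintro x ⟨y, hy, z, hz, hyz, hxy, hxz⟩
  by_contra! hlt
  rw [dist_comm] at hlt
  have hxp : infDist x M < ρ := (infDist_le_dist_of_mem hp).trans_lt hlt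
  have hyp : dist y p < 2 * ρ := by
    have := dist_triangle y x p
    rw [dist_comm y x] at this
    linarith
  have hzp : dist z p < 2 * ρ := by
    have := dist_triangle z x p
    rw [dist_comm z x] at this
    linarith
  have hny : IsNearestPoint M x y := ⟨hy, fun w hw => hxy ▸ infDist_le_dist_of_mem hw⟩
  obtain ⟨hfy, hgy⟩ := hsub (show y ∈ ball p r' from hyp.trans_le hρr')
  have hgy : m < ‖gradient f y‖ := hgy
  obtain ⟨c, hc⟩ := hfy.exists_eq_smul_gradient_of_isNearestPoint hny
  have hq := hquad y ⟨hy, hyp.trans_le hρr⟩ z ⟨hz, hzp.trans_le hρr⟩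
  have hnorm : ‖x - y‖ = ‖x - z‖ := by rw [← dist_eq_norm, ← dist_eq_norm, hxy, hxz]
  -- Equal distances give 2⟨x - y, z - y⟩ = ‖z - y‖². But `x - y` is a small multiple of the
  -- gradient at `y`, so the quadratic bound makes the left side smaller than that.
  have hexp : ‖x - z‖ ^ 2 = ‖x - y‖ ^ 2 - 2 * ⟪x - y, z - y⟫ + ‖z - y‖ ^ 2 := by
    rw [← norm_sub_sq_real]; congr 2; abel
  rw [← hnorm, hc, inner_smul_left] at hexp
  simp only [conj_trivial] at hexp
  have hzy : 0 < ‖z - y‖ ^ 2 := by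
    have : z - y ≠ 0 := sub_ne_zero.2 hyz.symm
    positivity
  have hcs : |c| * m ≤ ρ := by
    have h1 : ‖x - y‖ < ρ := by rw [← dist_eq_norm, hxy]; exact hxp
    rw [hc, norm_smul, Real.norm_eq_abs] at h1
    have := mul_le_mul_of_nonneg_left hgy.le (abs_nonneg c)
    linarith
  have h2 : c * ⟪gradient f y, z - y⟫ ≤ |c| * (K * ‖z - y‖ ^ 2) := by
    refine (le_abs_self _).trans ?_
    rw [abs_mul]
    exact mul_le_mul_of_nonneg_left hq (abs_nonneg c)
  have h3 : 2 * |c| * K < 1 := by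
    by_contra! hcon
    have : 2 * K * (|c| * m) ≤ 2 * K * ρ := by gcongr
    nlinarith
  nlinarith

/-- The normal segment at `p` starts with points whose nearest point is `p`. -/
theorem exists_isNearestPoint_add_smul (hM : IsClosedSurface M) {p n : E3} (hp : p ∈ M)
    (hn : IsNormalVector M p n) (hn1 : ‖n‖ = 1) :
    ∃ t > (0 : ℝ), IsNearestPoint M (p + t • n) p := by
  obtain ⟨f, hf⟩ := hM.exists_defining p hp
  obtain ⟨K, hK, r, hr, hquad⟩ := hf.exists_quadratic_bound
  obtain ⟨c, hc⟩ := hf.exists_eq_smul_gradient_of_isNormalVector hp hn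
  obtain ⟨t, ht, htr, htc⟩ : ∃ t > 0, 2 * t ≤ r ∧ 2 * (|c| * K) * t ≤ 1 := by
    refine ⟨min (r / 2) (1 / (2 * (|c| * K + 1))), by positivity, ?_, ?_⟩
    · linarith [min_le_left (r / 2) (1 / (2 * (|c| * K + 1)))]
    · have h := min_le_right (r / 2) (1 / (2 * (|c| * K + 1)))
      rw [le_div_iff₀ (by positivity)] at h
      have h0 : 0 ≤ min (r / 2) (1 / (2 * (|c| * K + 1))) := by positivity
      linarith
  refine ⟨t, ht, hp, fun z hz => ?_⟩
  have htn : ‖t • n‖ = t := by rw [norm_smul, hn1, mul_one, Real.norm_of_nonneg ht.le]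
  rw [dist_self_add_left, htn]
  by_cases hzr : dist z p < r
  · have hq := hquad p ⟨hp, mem_ball_self hr⟩ z ⟨hz, hzr⟩
    rw [dist_eq_norm]
    refine le_of_sq_le_sq ?_ (norm_nonneg _)
    have : p + t • n - z = t • n - (z - p) := by abel
    rw [this, norm_sub_sq_real, htn, inner_smul_left, hc, inner_smul_left]
    simp only [conj_trivial]
    have h2 : c * ⟪gradient f p, z - p⟫ ≤ |c| * (K * ‖z - p‖ ^ 2) := by
      refine (le_abs_self _).trans ?_
      rw [abs_mul]
      exact mul_le_mul_of_nonneg_left hq (abs_nonneg c)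
    have h3 : t * (c * ⟪gradient f p, z - p⟫) ≤ t * (|c| * (K * ‖z - p‖ ^ 2)) :=
      mul_le_mul_of_nonneg_left h2 ht.le
    nlinarith [sq_nonneg ‖z - p‖]
  · have h1 : dist z p ≤ dist z (p + t • n) + dist (p + t • n) p := dist_triangle _ _ _
    rw [dist_self_add_left, htn, dist_comm z (p + t • n)] at h1
    linarith

end IsClosedSurface

/-! ### Empty tangent balls, `ebs` and `lfs` -/

/-- Squaring the distances leaves a condition linear in `s`, hence closed in `s`; it is also the
form the face estimate needs. -/
theorem isNearestPoint_add_smul_iff {M : Set E3} {p n : E3} (hp : p ∈ M) (hn : ‖n‖ = 1) {s : ℝ}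
    (hs : 0 ≤ s) :
    IsNearestPoint M (p + s • n) p ↔ ∀ z ∈ M, 2 * s * ⟪n, z - p⟫ ≤ ‖z - p‖ ^ 2 := by
  have hsn : ‖s • n‖ = s := by rw [norm_smul, hn, mul_one, Real.norm_of_nonneg hs]
  have key : ∀ z, s ≤ dist (p + s • n) z ↔ 2 * s * ⟪n, z - p⟫ ≤ ‖z - p‖ ^ 2 := by
    intro z
    rw [dist_eq_norm, ← pow_le_pow_iff_left₀ hs (norm_nonneg _) two_ne_zero]
    have : p + s • n - z = s • n - (z - p) := by abel
    rw [this, norm_sub_sq_real, hsn, inner_smul_left]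
    simp only [conj_trivial]
    constructor <;> intro h <;> linarith
  unfold IsNearestPoint
  rw [dist_self_add_left, hsn]
  simp only [key, hp, true_and]

theorem IsMedialBallAt.ebs_le {M : Set E3} {p c : E3} {r : ℝ} (h : IsMedialBallAt M p c r) :
    ebs M p ≤ r := by
  refine csInf_le ⟨0, ?_⟩ ⟨c, h⟩
  rintro t ⟨d, hd⟩
  rw [← mem_sphere.1 hd.2.2]
  exact dist_nonneg

theorem notMem_medialAxis_of_dist_lt_lfs {M : Set E3} {p x : E3} (h : dist p x < lfs M p) :
    x ∉ medialAxis M :=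
  fun hx => absurd (infDist_le_dist_of_mem hx) (not_le.2 h)

namespace IsClosedSurface

variable {M : Set E3}

/-- Along a normal ray, `p` stays the nearest point until the centre of a medial ball. -/
theorem isNearestPoint_or_exists_isMedialBallAt (hM : IsClosedSurface M) {p n : E3} (hp : p ∈ M)
    (hn : IsNormalVector M p n) (hn1 : ‖n‖ = 1) {s : ℝ} (hs : 0 < s) :
    IsNearestPoint M (p + s • n) p ∨
      ∃ t, 0 < t ∧ t < s ∧ IsMedialBallAt M p (p + t • n) t := by
  set T : Set ℝ := {t | t ∈ Icc 0 s ∧ ∀ z ∈ M, 2 * t * ⟪n, z - p⟫ ≤ ‖z - p‖ ^ 2} with hT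
  have hTclosed : IsClosed T := by
    have : T = Icc 0 s ∩ ⋂ z ∈ M, {t : ℝ | 2 * t * ⟪n, z - p⟫ ≤ ‖z - p‖ ^ 2} := by
      ext t; simp [hT]
    rw [this]
    refine isClosed_Icc.inter (isClosed_biInter fun z _ => ?_)
    exact isClosed_le (by fun_prop) continuous_const
  have hTcomp : IsCompact T := isCompact_Icc.of_isClosed_subset hTclosed fun t ht => ht.1
  have hmem : ∀ {t : ℝ}, t ∈ Icc 0 s → IsNearestPoint M (p + t • n) p → t ∈ T :=
    fun ht h => ⟨ht, (isNearestPoint_add_smul_iff hp hn1 ht.1).1 h⟩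
  have hTne : T.Nonempty :=
    ⟨0, hmem ⟨le_rfl, hs.le⟩ (by simpa using isNearestPoint_self hp)⟩
  obtain ⟨τ, hτT, hτmax⟩ := hTcomp.exists_isMaxOn hTne continuousOn_id
  have hτn : IsNearestPoint M (p + τ • n) p :=
    (isNearestPoint_add_smul_iff hp hn1 hτT.1.1).2 hτT.2
  have hτpos : 0 < τ := by
    obtain ⟨t, ht, htn⟩ := hM.exists_isNearestPoint_add_smul hp hn hn1
    have hmin : 0 < min t s := lt_min ht hs
    exact hmin.trans_le (hτmax (hmem ⟨hmin.le, min_le_right _ _⟩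
      (htn.add_smul_of_le hmin.le (min_le_left _ _))))
  rcases hτT.1.2.eq_or_lt with rfl | hτs
  · exact Or.inl hτn
  refine Or.inr ⟨τ, hτpos, hτs, ?_, ?_, ?_⟩
  -- Were the centre at the maximal parameter `τ` off the medial axis, the segment could be
  -- extended, against maximality.
  · by_contra hmed
    have hτ0 : τ • n ≠ 0 := smul_ne_zero hτpos.ne' (norm_ne_zero_iff.1 (by rw [hn1]; norm_num))
    obtain ⟨ε, hε, h⟩ := hτn.exists_extension hM.isCompact hmed (by simpa using hτ0)
    have heq : p + τ • n + ε • (p + τ • n - p) = p + (τ + ε * τ) • n := by module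
    rw [heq] at h
    have hlt : τ < min (τ + ε * τ) s := lt_min (by nlinarith) hτs
    have h' := hτmax (hmem ⟨(hτpos.trans hlt).le, min_le_right _ _⟩
      (h.add_smul_of_le (hτpos.trans hlt).le (min_le_left _ _)))
    exact absurd hlt (not_lt.2 h')
  · have := (isNearestPoint_iff_disjoint_ball hp).1 hτn
    rwa [dist_self_add_left, norm_smul, hn1, mul_one, Real.norm_of_nonneg hτpos.le] at this
  · rw [mem_sphere, dist_self_add_right, norm_smul, hn1, mul_one, Real.norm_of_nonneg hτpos.le]

/-- A closed surface is not contained in a plane. -/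
theorem exists_inner_ne_zero (hM : IsClosedSurface M) {p n : E3} (hp : p ∈ M) (hn : n ≠ 0) :
    ∃ z ∈ M, ⟪n, z - p⟫ ≠ 0 := by
  by_contra! hplane
  obtain ⟨u, hu0, hun⟩ : ∃ u : E3, u ≠ 0 ∧ ⟪n, u⟫ = 0 := by
    have : Fact (Module.finrank ℝ E3 = 2 + 1) := ⟨by simp⟩
    have h2 := Submodule.finrank_orthogonal_span_singleton (𝕜 := ℝ) (n := 2) hn
    have : Nontrivial (Submodule.span ℝ {n})ᗮ :=
      Module.nontrivial_of_finrank_pos (R := ℝ) (by rw [h2]; norm_num)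
    obtain ⟨u, hu⟩ := exists_ne (0 : (Submodule.span ℝ {n})ᗮ)
    exact ⟨u, by simpa using hu, Submodule.mem_orthogonal_singleton_iff_inner_right.1 u.2⟩
  have hd : ∀ v q : E3, HasStrictFDerivAt (fun z => ⟪v, z⟫) (innerSL ℝ v) q :=
    fun v q => (innerSL ℝ v).hasStrictFDerivAt
  -- At a point of `M` extreme in the direction `u`, the vector `u` is normal; so is `n`, as ⟨n, ·⟩
  -- is constant on `M`. Orthogonal nonzero vectors cannot both span the normal line.
  obtain ⟨q, hq, hmax⟩ := hM.isCompact.exists_isMaxOn ⟨p, hp⟩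
    (f := fun z => ⟪u, z⟫) (by fun_prop)
  obtain ⟨f, hf⟩ := hM.exists_defining q hq
  obtain ⟨a, ha⟩ := hf.exists_eq_smul_gradient_of_isLocalExtrOn hq hmax.localize.isExtr (hd u q)
  have hconst : ∀ z ∈ M, ⟪n, z⟫ = ⟪n, p⟫ := fun z hz => by
    have := hplane z hz
    rwa [inner_sub_right, sub_eq_zero] at this
  have hextr : IsLocalExtrOn (fun z => ⟪n, z⟫) M q := by
    refine IsMinFilter.isExtr ?_
    filter_upwards [self_mem_nhdsWithin] with z hz
    rw [hconst z hz, hconst q hq]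
  obtain ⟨b, hb⟩ := hf.exists_eq_smul_gradient_of_isLocalExtrOn hq hextr (hd n q)
  rw [ha, hb, inner_smul_left, inner_smul_right, real_inner_self_eq_norm_sq] at hun
  simp only [conj_trivial, mul_eq_zero, pow_eq_zero_iff two_ne_zero, norm_eq_zero,
    hf.gradient_ne_zero, or_false] at hun
  rcases hun with h | h
  · exact hn (by rw [hb, h, zero_smul])
  · exact hu0 (by rw [ha, h, zero_smul])

/-- Without medial balls, arbitrarily large balls on both sides of `p` would be empty, which
squeezes `M` into its tangent plane. Existence keeps `lfs` and `ebs` from taking the default value 0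
of an infimum over the empty set. -/
theorem exists_isMedialBallAt (hM : IsClosedSurface M) {p : E3} (hp : p ∈ M) :
    ∃ c r, IsMedialBallAt M p c r := by
  by_contra! hno
  obtain ⟨n, hn, hn1⟩ := hM.exists_unit_normal hp
  have hhalf : ∀ m : E3, IsNormalVector M p m → ‖m‖ = 1 → ∀ z ∈ M, ⟪m, z - p⟫ ≤ 0 := by
    intro m hm hm1 z hz
    by_contra! hpos
    -- A radius large enough that the tangent ball would contain `z`.
    have hs : 0 < (‖z - p‖ ^ 2 + 1) / ⟪m, z - p⟫ := by positivity
    have h := ((hM.isNearestPoint_or_exists_isMedialBallAt hp hm hm1 hs).resolve_right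
      (by rintro ⟨t, -, -, h⟩; exact hno _ _ h))
    have h' := (isNearestPoint_add_smul_iff hp hm1 hs.le).1 h z hz
    rw [mul_assoc, div_mul_cancel₀ _ hpos.ne'] at h'
    linarith [sq_nonneg ‖z - p‖]
  have hn0 : n ≠ 0 := norm_ne_zero_iff.1 (by rw [hn1]; norm_num)
  obtain ⟨z, hz, hne⟩ := hM.exists_inner_ne_zero hp hn0
  refine hne (le_antisymm (hhalf n hn hn1 z hz) ?_)
  have := hhalf (-n) (by simpa using hn.smul (-1)) (by rw [norm_neg, hn1]) z hz
  rw [inner_neg_left] at this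
  linarith

theorem lfs_pos (hM : IsClosedSurface M) {p : E3} (hp : p ∈ M) : 0 < lfs M p := by
  obtain ⟨c, r, h⟩ := hM.exists_isMedialBallAt hp
  exact (isClosed_closure.notMem_iff_infDist_pos ⟨c, h.1⟩).1 (hM.notMem_medialAxis hp)

theorem ebs_pos (hM : IsClosedSurface M) {p : E3} (hp : p ∈ M) : 0 < ebs M p := by
  refine (hM.lfs_pos hp).trans_le ?_
  obtain ⟨c, r, h⟩ := hM.exists_isMedialBallAt hp
  refine le_csInf ⟨r, c, h⟩ ?_
  rintro t ⟨d, hd⟩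
  rw [← mem_sphere.1 hd.2.2]
  exact infDist_le_dist_of_mem hd.1

/-- The surface lies outside the two tangent balls whose radius is the empty ball size. -/
theorem two_mul_ebs_mul_abs_inner_le (hM : IsClosedSurface M) {p n z : E3} (hp : p ∈ M)
    (hn : IsNormalVector M p n) (hn1 : ‖n‖ = 1) (hz : z ∈ M) :
    2 * ebs M p * |⟪n, z - p⟫| ≤ ‖z - p‖ ^ 2 := by
  have key : ∀ m : E3, IsNormalVector M p m → ‖m‖ = 1 →
      2 * ebs M p * ⟪m, z - p⟫ ≤ ‖z - p‖ ^ 2 := by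
    intro m hm hm1
    refine (isNearestPoint_add_smul_iff hp hm1 (hM.ebs_pos hp).le).1 ?_ z hz
    refine (hM.isNearestPoint_or_exists_isMedialBallAt hp hm hm1 (hM.ebs_pos hp)).resolve_right ?_
    rintro ⟨t, -, hlt, h⟩
    exact absurd h.ebs_le (not_le.2 hlt)
  rcases abs_cases ⟪n, z - p⟫ with ⟨h, -⟩ | ⟨h, -⟩
  · rw [h]; exact key n hn hn1
  · rw [h, ← inner_neg_left]
    exact key (-n) (by simpa using hn.smul (-1)) (by rw [norm_neg, hn1])

/-- A normal segment that avoids the medial axis has its foot as nearest point. -/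
theorem isNearestPoint_of_notMem_medialAxis (hM : IsClosedSurface M) {p n : E3} (hp : p ∈ M)
    (hn : IsNormalVector M p n) (hn1 : ‖n‖ = 1) {s : ℝ} (hs : 0 < s)
    (h : ∀ t, 0 < t → t < s → p + t • n ∉ medialAxis M) : IsNearestPoint M (p + s • n) p := by
  refine (hM.isNearestPoint_or_exists_isMedialBallAt hp hn hn1 hs).resolve_right ?_
  rintro ⟨t, ht, hts, hb⟩
  exact h t ht hts hb.1

end IsClosedSurface

/-! ### From a face normal to the surface normal at a vertex -/

/-- The Gram determinant formula for the squared norm of a vector in the plane with normal `N`. -/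
theorem gram_mul_norm_sq {N a b u : E3} (hN : N ≠ 0) (ha : ⟪a, N⟫ = 0) (hb : ⟪b, N⟫ = 0)
    (hu : ⟪u, N⟫ = 0) (hG : 0 < ‖a‖ ^ 2 * ‖b‖ ^ 2 - ⟪a, b⟫ ^ 2) :
    (‖a‖ ^ 2 * ‖b‖ ^ 2 - ⟪a, b⟫ ^ 2) * ‖u‖ ^ 2 =
      ⟪u, a⟫ ^ 2 * ‖b‖ ^ 2 + ⟪u, b⟫ ^ 2 * ‖a‖ ^ 2 - 2 * ⟪u, a⟫ * ⟪u, b⟫ * ⟪a, b⟫ := by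
  set G := ‖a‖ ^ 2 * ‖b‖ ^ 2 - ⟪a, b⟫ ^ 2 with hGdef
  set α := ⟪u, a⟫ * ‖b‖ ^ 2 - ⟪u, b⟫ * ⟪a, b⟫ with hα
  set β := ⟪u, b⟫ * ‖a‖ ^ 2 - ⟪u, a⟫ * ⟪a, b⟫ with hβ
  -- By Cramer's rule `w` is orthogonal to `a` and `b`, hence parallel to `N`; it is also orthogonal
  -- to `N`, so it vanishes. Pairing with `u` gives the formula.
  set w := G • u - α • a - β • b with hw
  have haa : ⟪a, a⟫ = ‖a‖ ^ 2 := real_inner_self_eq_norm_sq a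
  have hbb : ⟪b, b⟫ = ‖b‖ ^ 2 := real_inner_self_eq_norm_sq b
  have hba : ⟪b, a⟫ = ⟪a, b⟫ := real_inner_comm _ _
  have hwa : ⟪a, w⟫ = 0 := by
    rw [real_inner_comm, hw]
    simp only [inner_sub_left, inner_smul_left, conj_trivial, haa, hba, hα, hβ, hGdef]
    ring
  have hwb : ⟪b, w⟫ = 0 := by
    rw [real_inner_comm, hw]
    simp only [inner_sub_left, inner_smul_left, conj_trivial, hbb, hα, hβ, hGdef]
    ring
  have hwN : ⟪w, N⟫ = 0 := by
    rw [hw]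
    simp [inner_sub_left, inner_smul_left, ha, hb, hu]
  have hli : LinearIndependent ℝ ![a, b] := by
    rw [LinearIndependent.pair_iff]
    intro s t hst
    have h1 : s * ‖a‖ ^ 2 + t * ⟪a, b⟫ = 0 := by
      have := congrArg (fun v => ⟪v, a⟫) hst
      simpa [inner_add_left, inner_smul_left, haa, hba] using this
    have h2 : s * ⟪a, b⟫ + t * ‖b‖ ^ 2 = 0 := by
      have := congrArg (fun v => ⟪v, b⟫) hst
      simpa [inner_add_left, inner_smul_left, hbb] using this
    have hs : s * G = 0 := by rw [hGdef]; linear_combination ‖b‖ ^ 2 * h1 - ⟪a, b⟫ * h2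
    have ht : t * G = 0 := by rw [hGdef]; linear_combination ‖a‖ ^ 2 * h2 - ⟪a, b⟫ * h1
    exact ⟨(mul_eq_zero.1 hs).resolve_right hG.ne', (mul_eq_zero.1 ht).resolve_right hG.ne'⟩
  set D := Submodule.span ℝ (range ![a, b]) with hD
  have hD2 : Module.finrank ℝ D = 2 := by simpa using finrank_span_eq_card hli
  have hDo : Module.finrank ℝ Dᗮ = 1 := by
    have := D.finrank_add_finrank_orthogonal
    rw [hD2, finrank_euclideanSpace_fin] at this
    omega
  have hmem : ∀ v : E3, ⟪a, v⟫ = 0 → ⟪b, v⟫ = 0 → v ∈ Dᗮ := by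
    intro v hav hbv
    rw [Submodule.mem_orthogonal]
    intro x hx
    induction hx using Submodule.span_induction with
    | mem x hx =>
      obtain ⟨j, rfl⟩ := hx
      fin_cases j
      · exact hav
      · exact hbv
    | zero => exact inner_zero_left _
    | add x y _ _ h1 h2 => rw [inner_add_left, h1, h2, add_zero]
    | smul c x _ h => rw [inner_smul_left, h, mul_zero]
  obtain ⟨c, hc⟩ := (finrank_eq_one_iff_of_nonzero' (⟨N, hmem N ha hb⟩ : Dᗮ)
    (fun h => hN (congrArg Subtype.val h))).1 hDo ⟨w, hmem w hwa hwb⟩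
  have hc : c • N = w := congrArg Subtype.val hc
  have hw0 : w = 0 := by
    have : ⟪w, w⟫ = 0 := by nth_rw 2 [← hc]; rw [inner_smul_right, hwN, mul_zero]
    exact inner_self_eq_zero.1 this
  have := congrArg (fun v => ⟪u, v⟫) hw0
  simp only [hw, inner_sub_right, inner_smul_right, inner_zero_right,
    real_inner_self_eq_norm_sq] at this
  rw [hα, hβ] at this
  linear_combination this

/-- For triangle sides `x`, `y` enclosing an angle with cosine `c` and sine `s`, and circumradius
`R`: a bound for a segment in terms of its projections to the sides. -/
theorem mul_le_circumradius_mul_max {x y c s R r U A B : ℝ} (hx : 0 < x) (hy : 0 < y) (hs : 0 < s)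
    (hR : 0 ≤ R) (hr : 0 ≤ r) (hcs : c ^ 2 + s ^ 2 = 1)
    (hlaw : x ^ 2 + y ^ 2 - 2 * x * y * c = 4 * R ^ 2 * s ^ 2)
    (hA : 2 * r * |A| ≤ x ^ 2) (hB : 2 * r * |B| ≤ y ^ 2)
    (hgram : x ^ 2 * y ^ 2 * s ^ 2 * U ^ 2 =
      A ^ 2 * y ^ 2 + B ^ 2 * x ^ 2 - 2 * A * B * (x * y * c)) :
    r * U ≤ R * max ((1 + c) / s) 1 := by
  have hA2 : 4 * r ^ 2 * A ^ 2 ≤ x ^ 4 := by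
    have := pow_le_pow_left₀ (by positivity) hA 2
    rw [mul_pow, sq_abs] at this
    linarith
  have hB2 : 4 * r ^ 2 * B ^ 2 ≤ y ^ 4 := by
    have := pow_le_pow_left₀ (by positivity) hB 2
    rw [mul_pow, sq_abs] at this
    linarith
  have hAB : 4 * r ^ 2 * (|A| * |B|) ≤ x ^ 2 * y ^ 2 := by
    have := mul_le_mul hA hB (by positivity) (by positivity)
    linarith
  have hABc : -(A * B * c) ≤ |A| * |B| * |c| := by
    rw [← abs_mul, ← abs_mul]; exact neg_le_abs _
  have hmain : 4 * r ^ 2 * (s ^ 2 * U ^ 2) ≤ x ^ 2 + y ^ 2 + 2 * x * y * |c| := by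
    have h1 : x ^ 2 * y ^ 2 * (4 * r ^ 2 * (s ^ 2 * U ^ 2)) ≤
        x ^ 2 * y ^ 2 * (x ^ 2 + y ^ 2 + 2 * x * y * |c|) := by
      have e1 : 4 * r ^ 2 * A ^ 2 * y ^ 2 ≤ x ^ 4 * y ^ 2 := by gcongr
      have e2 : 4 * r ^ 2 * B ^ 2 * x ^ 2 ≤ y ^ 4 * x ^ 2 := by gcongr
      have e3 : 4 * r ^ 2 * (|A| * |B|) * (2 * x * y * |c|) ≤
          x ^ 2 * y ^ 2 * (2 * x * y * |c|) := by gcongr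
      have e4 : 8 * r ^ 2 * (x * y) * (-(A * B * c)) ≤
          8 * r ^ 2 * (x * y) * (|A| * |B| * |c|) := by gcongr
      have e5 : x ^ 2 * y ^ 2 * (4 * r ^ 2 * (s ^ 2 * U ^ 2)) =
          4 * r ^ 2 * A ^ 2 * y ^ 2 + 4 * r ^ 2 * B ^ 2 * x ^ 2 +
            8 * r ^ 2 * (x * y) * (-(A * B * c)) := by
        linear_combination 4 * r ^ 2 * hgram
      nlinarith
    exact le_of_mul_le_mul_left h1 (by positivity)
  -- For c ≤ 0 the right side of `hmain` is 4R²s² by `hlaw`. For c > 0 it exceeds that by 4xyc, and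
  -- (x - y)² ≥ 0 gives xy ≤ 2R²(1 + c), for a total of at most 4R²(1 + c)².
  rcases le_or_gt c 0 with hc | hc
  · rw [abs_of_nonpos hc] at hmain
    have h1 : r * U ≤ R := by
      refine le_of_sq_le_sq ?_ hR
      have : s ^ 2 * (r * U) ^ 2 ≤ s ^ 2 * R ^ 2 := by nlinarith
      exact le_of_mul_le_mul_left this (by positivity)
    exact h1.trans (le_mul_of_one_le_right hR (le_max_right _ _))
  · rw [abs_of_pos hc] at hmain
    have hxy : x * y ≤ 2 * R ^ 2 * (1 + c) := by
      have hc1 : 0 < 1 - c := by nlinarith [sq_pos_of_pos hs]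
      have : x * y * (1 - c) ≤ 2 * R ^ 2 * (1 + c) * (1 - c) := by
        nlinarith [sq_nonneg (x - y)]
      exact le_of_mul_le_mul_right this hc1
    have h1 : r * U * s ≤ R * (1 + c) := by
      refine le_of_sq_le_sq ?_ (by positivity)
      have : 4 * (x * y) * c ≤ 4 * (2 * R ^ 2 * (1 + c)) * c := by gcongr
      have h2 : 4 * R ^ 2 * s ^ 2 = 4 * R ^ 2 * (1 - c ^ 2) := by rw [← hcs]; ring
      nlinarith
    have h2 : r * U ≤ R * ((1 + c) / s) := by
      rw [← mul_div_assoc, le_div_iff₀ hs]; exact h1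
    exact h2.trans (mul_le_mul_of_nonneg_left (le_max_left _ _) hR)

theorem cot_half (x : ℝ) (hx : Real.sin x ≠ 0) :
    Real.cot (x / 2) = (1 + Real.cos x) / Real.sin x := by
  have h1 : Real.sin x = 2 * Real.sin (x / 2) * Real.cos (x / 2) := by
    rw [← Real.sin_two_mul]; congr 1; ring
  have h2 : Real.cos x = 2 * Real.cos (x / 2) ^ 2 - 1 := by
    rw [← Real.cos_two_mul]; congr 1; ring
  have hs : Real.sin (x / 2) ≠ 0 := fun h => hx (by rw [h1, h]; ring)
  have hc : Real.cos (x / 2) ≠ 0 := fun h => hx (by rw [h1, h]; ring)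
  rw [Real.cot_eq_cos_div_sin, h1, h2]
  field_simp
  ring

theorem IsFaceNormal.inner_vsub {T : Affine.Triangle ℝ E3} {N : E3} (hN : IsFaceNormal T N)
    (i j : Fin 3) : ⟪T.points i - T.points j, N⟫ = 0 := by
  refine hN.2 _ ?_
  rw [direction_affineSpan]
  exact vsub_mem_vectorSpan ℝ ⟨i, rfl⟩ ⟨j, rfl⟩

/-- The face normal and the surface normal at a vertex differ by at most the face term. -/
theorem IsClosedSurface.lineAngle_le_faceTerm {M : Set E3} (hM : IsClosedSurface M)
    {T : Affine.Triangle ℝ E3} (hT : ∀ i, T.points i ∈ M) (i : Fin 3) {N n : E3}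
    (hN : IsFaceNormal T N) (hn : IsNormalVector M (T.points i) n) (hn1 : ‖n‖ = 1) :
    lineAngle N n ≤ faceTerm M T i := by
  have hN0 : 0 < ‖N‖ := norm_pos_iff.2 hN.1
  have hr := hM.ebs_pos (hT i)
  have hR := T.circumradius_pos
  set r := ebs M (T.points i) with hrdef
  set R := T.circumradius
  set φ := planeAngle T i with hφ
  set a := T.points (i + 1) - T.points i with ha
  set b := T.points (i + 2) - T.points i with hb
  have h01 : i + 1 ≠ i := by simp
  have h02 : i ≠ i + 2 := (by decide : ∀ j : Fin 3, j ≠ j + 2) i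
  have h12 : i + 1 ≠ i + 2 := by simp
  have hnc : ¬ Collinear ℝ {T.points (i + 1), T.points i, T.points (i + 2)} :=
    (affineIndependent_iff_not_collinear_of_ne h01 h12 h02).1 T.independent
  have hs : 0 < Real.sin φ := EuclideanGeometry.sin_pos_of_not_collinear hnc
  have ha0 : 0 < ‖a‖ := norm_pos_iff.2 (sub_ne_zero.2 (T.independent.injective.ne h01))
  have hb0 : 0 < ‖b‖ := norm_pos_iff.2 (sub_ne_zero.2 (T.independent.injective.ne h02.symm))
  have hab : ⟪a, b⟫ = ‖a‖ * ‖b‖ * Real.cos φ := by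
    have := InnerProductGeometry.cos_angle_mul_norm_mul_norm a b
    rw [← this, mul_comm]; rfl
  have hcs : Real.cos φ ^ 2 + Real.sin φ ^ 2 = 1 := Real.cos_sq_add_sin_sq φ
  have hGram : ‖a‖ ^ 2 * ‖b‖ ^ 2 - ⟪a, b⟫ ^ 2 = ‖a‖ ^ 2 * ‖b‖ ^ 2 * Real.sin φ ^ 2 := by
    rw [hab]; linear_combination -(‖a‖ ^ 2 * ‖b‖ ^ 2) * hcs
  have hlaw : ‖a‖ ^ 2 + ‖b‖ ^ 2 - 2 * ‖a‖ * ‖b‖ * Real.cos φ = 4 * R ^ 2 * Real.sin φ ^ 2 := by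
    have h1 := T.dist_div_sin_angle_eq_two_mul_circumradius h01 h12 h02
    have h1 : dist (T.points (i + 1)) (T.points (i + 2)) = 2 * R * Real.sin φ :=
      (div_eq_iff hs.ne').1 h1
    have h2 : ‖a - b‖ = 2 * R * Real.sin φ := by
      rw [← h1, dist_eq_norm, ha, hb]; congr 1; abel
    have h3 := norm_sub_sq_real a b
    rw [h2, hab] at h3
    linear_combination -h3
  -- The component of `n` in the plane of the face; its length is the sine of the line angle.
  set u := n - (⟪N, n⟫ / ‖N‖ ^ 2) • N with hu
  have huN : ⟪u, N⟫ = 0 := by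
    rw [hu, inner_sub_left, inner_smul_left, real_inner_self_eq_norm_sq, real_inner_comm]
    simp only [conj_trivial]
    field_simp
    ring
  have haN : ⟪a, N⟫ = 0 := hN.inner_vsub _ _
  have hbN : ⟪b, N⟫ = 0 := hN.inner_vsub _ _
  have hua : ⟪u, a⟫ = ⟪n, a⟫ := by
    rw [hu, inner_sub_left, inner_smul_left, real_inner_comm, real_inner_comm a N, haN]
    simp [real_inner_comm]
  have hub : ⟪u, b⟫ = ⟪n, b⟫ := by
    rw [hu, inner_sub_left, inner_smul_left, real_inner_comm, real_inner_comm b N, hbN]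
    simp [real_inner_comm]
  set X := |⟪N, n⟫| / (‖N‖ * ‖n‖) with hX
  have hX0 : 0 ≤ X := by positivity
  have hu2 : ‖u‖ ^ 2 = 1 - X ^ 2 := by
    rw [hu, norm_sub_sq_real, hn1, inner_smul_right, norm_smul, hX, hn1, mul_one, div_pow, sq_abs,
      mul_pow, Real.norm_eq_abs, sq_abs, real_inner_comm n N]
    field_simp
    ring
  have hG := gram_mul_norm_sq hN.1 haN hbN huN (by rw [hGram]; positivity)
  rw [hGram, hab, hua, hub] at hG
  have hmain := mul_le_circumradius_mul_max ha0 hb0 hs hR.le hr.le hcs hlaw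
    (hM.two_mul_ebs_mul_abs_inner_le (hT i) hn hn1 (hT (i + 1)))
    (hM.two_mul_ebs_mul_abs_inner_le (hT i) hn hn1 (hT (i + 2))) hG
  rw [lineAngle, faceTerm, Real.arccos_eq_arcsin hX0, ← hu2, Real.sqrt_sq (norm_nonneg _)]
  refine Real.monotone_arcsin ?_
  rw [cot_half _ hs.ne', div_mul_eq_mul_div, le_div_iff₀ hr, mul_comm]
  exact hmain

/-! ### Sides of the surface and opposite empty balls -/

/-- A continuous nowhere vanishing choice of normal vectors at the nearest points on `M` of the
points of `B`. -/
structure IsNormalLift (M B : Set E3) (W : E3 → E3) : Prop where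
  continuousOn : ContinuousOn W B
  ne_zero : ∀ x ∈ B, W x ≠ 0
  isNormal : ∀ x ∈ B, IsNormalVector M (proj M x) (W x)

namespace IsClosedSurface

variable {M : Set E3} {p : E3} {r : ℝ} {W : E3 → E3}

/-- A point of an empty ball touching `M` lies on the side of `M` that the ball lies on. -/
theorem side_pos (hM : IsClosedSurface M) (hr : r ≤ lfs M p) (hW : IsNormalLift M (ball p r) W)
    {y : E3} (hy : y ∈ M) (hyr : y ∈ ball p r) {k s : ℝ} (hs : 0 < s) (hk : ‖k • W y‖ = 1)
    (hnear : IsNearestPoint M (y + s • k • W y) y) {x : E3}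
    (hx : x ∈ ball (y + s • k • W y) s ∩ ball p r) : 0 < k * ⟪x - proj M x, W x⟫ := by
  have hne : M.Nonempty := ⟨y, hy⟩
  have hmed : ∀ z ∈ ball p r, z ∉ medialAxis M := fun z hz =>
    notMem_medialAxis_of_dist_lt_lfs (by rw [dist_comm]; exact (mem_ball.1 hz).trans_le hr)
  set n := k • W y with hn
  have hk0 : k ≠ 0 := by rintro rfl; simp [hn] at hk
  set C := ball (y + s • n) s ∩ ball p r with hC
  have hCM : Disjoint C M := by
    have h := (isNearestPoint_iff_disjoint_ball hy).1 hnear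
    rw [dist_self_add_left, norm_smul, hk, mul_one, Real.norm_of_nonneg hs.le] at h
    exact h.mono_left inter_subset_left
  have hWat : ∀ z ∈ ball p r, ContinuousAt W z := fun z hz =>
    hW.continuousOn.continuousAt (isOpen_ball.mem_nhds hz)
  -- This function is continuous and has no zero on the convex set `C`, so its sign is constant;
  -- just above `y` along `n` it is positive.
  have hcont : ContinuousOn (fun z => k * ⟪z - proj M z, W z⟫) C := by
    intro z hz
    have h1 := continuousAt_proj hM.isCompact hne (hmed z hz.2)
    have h2 := hWat z hz.2
    exact ContinuousAt.continuousWithinAt (by fun_prop)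
  have hnz : ∀ z ∈ C, k * ⟪z - proj M z, W z⟫ ≠ 0 := by
    intro z hz
    have hnp := isNearestPoint_proj hM.isCompact hne z
    obtain ⟨c, hc⟩ := (hW.isNormal z hz.2).exists_eq_smul hnp.1 (hW.ne_zero z hz.2)
      (hM.isNormalVector_sub hnp)
    have hz0 : z - proj M z ≠ 0 := fun h =>
      hCM.notMem_of_mem_left hz ((sub_eq_zero.1 h) ▸ hnp.1)
    have hc0 : c ≠ 0 := by rintro rfl; exact hz0 (by rw [hc, zero_smul])
    rw [hc, inner_smul_left, real_inner_self_eq_norm_sq]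
    have := norm_pos_iff.2 (hW.ne_zero z hz.2)
    simp only [conj_trivial]
    positivity
  obtain ⟨x₀, hx₀, hpos⟩ : ∃ x₀ ∈ C, 0 < k * ⟪x₀ - proj M x₀, W x₀⟫ := by
    have hline : ContinuousAt (fun t : ℝ => y + t • n) 0 := by fun_prop
    have hin : ∀ᶠ t in 𝓝 (0 : ℝ), y + t • n ∈ ball p r :=
      hline.eventually_mem (by rw [zero_smul, add_zero]; exact isOpen_ball.mem_nhds hyr)
    have hWline : ContinuousAt (fun t : ℝ => k * ⟪n, W (y + t • n)⟫) 0 := by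
      have h0 : ContinuousAt W (y + (0 : ℝ) • n) := by simpa using hWat y hyr
      have : ContinuousAt (fun t : ℝ => W (y + t • n)) 0 :=
        h0.comp (f := fun t : ℝ => y + t • n) hline
      fun_prop
    have hval : k * ⟪n, W (y + (0 : ℝ) • n)⟫ = 1 := by
      rw [zero_smul, add_zero, ← inner_smul_right, ← hn, real_inner_self_eq_norm_sq, hk, one_pow]
    have hev : ∀ᶠ t in 𝓝 (0 : ℝ), 0 < k * ⟪n, W (y + t • n)⟫ :=
      hWline.eventually_const_lt (lt_of_lt_of_eq one_pos hval.symm)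
    have hall : ∀ᶠ t in 𝓝 (0 : ℝ), (y + t • n ∈ ball p r ∧ 0 < k * ⟪n, W (y + t • n)⟫) ∧ t < s :=
      (hin.and hev).and (eventually_lt_nhds hs)
    obtain ⟨t, ⟨⟨ht1, ht2⟩, hts⟩, ht0⟩ : ∃ t : ℝ, _ ∧ 0 < t :=
      ((hall.filter_mono nhdsWithin_le_nhds).and (self_mem_nhdsWithin (s := Ioi 0))).exists
    refine ⟨y + t • n, ⟨?_, ht1⟩, ?_⟩
    · rw [mem_ball, dist_add_left, dist_eq_norm, ← sub_smul, norm_smul, hk, mul_one,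
        Real.norm_eq_abs, abs_of_neg (by linarith)]
      linarith
    · rw [proj_eq (hmed _ ht1) (hnear.add_smul_of_le ht0.le hts.le), add_sub_cancel_left,
        inner_smul_left]
      simp only [conj_trivial]
      nlinarith
  by_contra! hle
  have hCc : IsPreconnected C := ((convex_ball _ _).inter (convex_ball _ _)).isPreconnected
  obtain ⟨z, hz, hz0⟩ := hCc.intermediate_value hx hx₀ hcont ⟨hle, hpos.le⟩
  exact hnz z hz hz0

/-- Empty balls on different sides of `M` do not overlap. -/
theorem add_le_dist_of_opposite (hM : IsClosedSurface M) (hr0 : 0 < r) (hr : r ≤ lfs M p)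
    (hW : IsNormalLift M (ball p r) W)
    {y z : E3} (hy : y ∈ M) (hyr : y ∈ ball p r) (hz : z ∈ M) (hzr : z ∈ ball p r)
    {k l s t : ℝ} (hs : 0 < s) (ht : 0 < t) (hk : ‖k • W y‖ = 1) (hl : ‖l • W z‖ = 1)
    (hkl : k * l < 0)
    (hyn : IsNearestPoint M (y + s • k • W y) y) (hzn : IsNearestPoint M (z + t • l • W z) z)
    (hyB : y + s • k • W y ∈ closedBall p r) (hzB : z + t • l • W z ∈ closedBall p r) :
    s + t ≤ dist (y + s • k • W y) (z + t • l • W z) := by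
  by_contra! hlt
  set a := y + s • k • W y
  set b := z + t • l • W z
  have hst : 0 < s + t := by positivity
  -- Dividing the segment of centres in the ratio of the radii gives a point in both balls.
  set θ := s / (s + t) with hθ
  have hθ0 : 0 ≤ θ := by positivity
  have hθ1 : θ ≤ 1 := (div_le_one hst).2 (by linarith)
  set w := a + θ • (b - a) with hw
  have hwB : w ∈ closure (ball p r) := by
    rw [closure_ball _ hr0.ne']
    exact (convex_closedBall p r).add_smul_sub_mem hyB hzB ⟨hθ0, hθ1⟩
  have hwa : w ∈ ball a s := by
    rw [mem_ball, hw, dist_self_add_left, norm_smul, Real.norm_of_nonneg hθ0, ← dist_eq_norm,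
      dist_comm, hθ, div_mul_eq_mul_div, div_lt_iff₀ hst]
    exact mul_lt_mul_of_pos_left hlt hs
  have hwb : w ∈ ball b t := by
    have h1 : w - b = (1 - θ) • (a - b) := by rw [hw]; module
    have h2 : 1 - θ = t / (s + t) := by rw [hθ]; field_simp; ring
    rw [mem_ball, dist_eq_norm, h1, norm_smul, Real.norm_of_nonneg (sub_nonneg.2 hθ1),
      ← dist_eq_norm, h2, div_mul_eq_mul_div, div_lt_iff₀ hst]
    exact mul_lt_mul_of_pos_left hlt ht
  -- Since `w` may lie on the bounding sphere, it is replaced by a nearby point of the open ball.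
  obtain ⟨x, ⟨hxa, hxb⟩, hxp⟩ := mem_closure_iff.1 hwB _ (isOpen_ball.inter isOpen_ball) ⟨hwa, hwb⟩
  have h1 := hM.side_pos hr hW hy hyr hs hk hyn ⟨hxa, hxp⟩
  have h2 := hM.side_pos hr hW hz hzr ht hl hzn ⟨hxb, hxp⟩
  nlinarith [mul_pos h1 h2, sq_nonneg ⟪x - proj M x, W x⟫]

end IsClosedSurface

/-! ### Variation of the surface normal -/

/-- Adding `h1` and `h2` cancels `g`, the unknown height of `q` over the tangent plane at `p`; then
`D ≥ h` removes the tilt `b`. -/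
theorem cos_bound_of_tangent_balls {r h b D C g : ℝ} (hr : 0 < r) (hh : 0 < h)
    (hD : D ^ 2 = b ^ 2 + h ^ 2) (hD0 : 0 < D) (hC : C ≤ 1)
    (h1 : ((D - b) + r) ^ 2 ≤ 2 * r ^ 2 + 2 * r * (g + (D - b) * C))
    (h2 : ((D + b) + r) ^ 2 ≤ 2 * r ^ 2 - 2 * r * (g - (D + b) * C)) :
    1 - (r ^ 2 - h ^ 2) / (2 * r * h) ≤ C := by
  have hhD : h ≤ D := le_of_sq_le_sq (by rw [hD]; nlinarith) hD0.le
  have h3 : 2 * r * D * (1 - C) ≤ r ^ 2 + h ^ 2 - 2 * D ^ 2 := by nlinarith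
  have h4 : 2 * r * h * (1 - C) ≤ 2 * r * D * (1 - C) := by
    have : 0 ≤ 1 - C := by linarith
    gcongr
  have h5 : h ^ 2 ≤ D ^ 2 := by gcongr
  have h6 : (1 - C) ≤ (r ^ 2 - h ^ 2) / (2 * r * h) := by
    rw [le_div_iff₀ (by positivity)]; linarith
  linarith

theorem IsClosedSurface.le_inner_normal_of_isNormalLift {M : Set E3} (hM : IsClosedSurface M)
    {p q : E3} (hp : p ∈ M) (hq : q ∈ M) {r : ℝ} (hr0 : 0 < r) (hr : r ≤ lfs M p)
    (hpq : dist p q < r) {W : E3 → E3} (hW : IsNormalLift M (ball p r) W)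
    {k l : ℝ} (hk : 0 < k) (hl : 0 < l) (hkn : ‖k • W p‖ = 1) (hln : ‖l • W q‖ = 1) :
    1 - (dist p q / r) ^ 2 / (2 * Real.sqrt (1 - (dist p q / r) ^ 2)) ≤
      ⟪k • W p, l • W q⟫ := by
  have hne : M.Nonempty := ⟨p, hp⟩
  have hpr : p ∈ ball p r := mem_ball_self hr0
  have hqr : q ∈ ball p r := by rw [mem_ball, dist_comm]; exact hpq
  have hprojM : ∀ {y}, y ∈ M → proj M y = y := fun {y} hy =>
    proj_eq (hM.notMem_medialAxis hy) (isNearestPoint_self hy)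
  have hmed : ∀ z ∈ ball p r, z ∉ medialAxis M := fun z hz =>
    notMem_medialAxis_of_dist_lt_lfs (by rw [dist_comm]; exact (mem_ball.1 hz).trans_le hr)
  have hnorm_p : ∀ c : ℝ, IsNormalVector M p (c • W p) := fun c => by
    have := hW.isNormal p hpr
    rw [hprojM hp] at this
    exact this.smul c
  have hnorm_q : ∀ c : ℝ, IsNormalVector M q (c • W q) := fun c => by
    have := hW.isNormal q hqr
    rw [hprojM hq] at this
    exact this.smul c
  have hkn' : ‖(-k) • W p‖ = 1 := by rw [neg_smul, norm_neg, hkn]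
  have hln' : ‖(-l) • W q‖ = 1 := by rw [neg_smul, norm_neg, hln]
  set ℓ := dist p q with hℓ
  have hℓ0 : 0 ≤ ℓ := dist_nonneg
  have hP : 0 < r ^ 2 - ℓ ^ 2 := by nlinarith
  set h := Real.sqrt (r ^ 2 - ℓ ^ 2) with hh
  have hh0 : 0 < h := Real.sqrt_pos.2 hP
  have hh2 : h ^ 2 = r ^ 2 - ℓ ^ 2 := Real.sq_sqrt hP.le
  set b := ⟪l • W q, q - p⟫ with hb
  -- The points q + t m, with m = `l • W q`, lie on the sphere about `p` of radius `r` exactly for t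
  -- = -b ± D. So `D - b` and `D + b` are the radii of the two balls at `q`.
  set D := Real.sqrt (b ^ 2 + h ^ 2) with hD
  have hD0 : 0 < D := Real.sqrt_pos.2 (by positivity)
  have hD2 : D ^ 2 = b ^ 2 + h ^ 2 := Real.sq_sqrt (by positivity)
  have hbD : |b| < D := by
    refine lt_of_pow_lt_pow_left₀ 2 hD0.le ?_
    rw [sq_abs, hD2]
    linarith [pow_pos hh0 2]
  have hs : 0 < D - b := by linarith [le_abs_self b]
  have hs' : 0 < D + b := by linarith [neg_le_abs b]
  have hqp : ‖q - p‖ ^ 2 = ℓ ^ 2 := by rw [hℓ, dist_comm, dist_eq_norm]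
  have hdist : ∀ c : ℝ, ∀ m : E3, ‖m‖ = 1 →
      dist (q + c • m) p ^ 2 = ℓ ^ 2 + 2 * c * ⟪m, q - p⟫ + c ^ 2 := by
    intro c m hm
    rw [dist_eq_norm, show q + c • m - p = (q - p) + c • m by abel, norm_add_sq_real, hqp,
      norm_smul, hm, inner_smul_right, real_inner_comm, mul_one, Real.norm_eq_abs, sq_abs]
    ring
  have hbneg : ⟪(-l) • W q, q - p⟫ = -b := by rw [neg_smul, inner_neg_left]
  have near : ∀ (c : ℝ) (m : E3) (s : ℝ), m = c • W q → ‖m‖ = 1 → s = D - ⟪m, q - p⟫ → ⟪m, q - p⟫ ^ 2 = b ^ 2 →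
      0 < s → q + s • m ∈ closedBall p r ∧ IsNearestPoint M (q + s • m) q := by
    intro c m s hmc hm hsD hmb hs0
    constructor
    · rw [mem_closedBall]
      refine le_of_sq_le_sq ?_ hr0.le
      rw [hdist s m hm, hsD]
      nlinarith
    · refine hM.isNearestPoint_of_notMem_medialAxis hq (hmc ▸ hnorm_q c) hm hs0
        fun t ht hts => hmed _ ?_
      rw [mem_ball]
      refine lt_of_pow_lt_pow_left₀ 2 hr0.le ?_
      rw [hdist t m hm]
      have hDm : 0 < D + ⟪m, q - p⟫ := by
        have := (abs_lt.1 (abs_lt_of_sq_lt_sq (by rw [hmb, hD2]; nlinarith) hD0.le)).1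
        linarith
      nlinarith [mul_pos (sub_pos.2 hts) (add_pos ht hDm)]
  have nearp : ∀ c : ℝ, ‖c • W p‖ = 1 →
      p + r • c • W p ∈ closedBall p r ∧ IsNearestPoint M (p + r • c • W p) p := by
    intro c hc
    constructor
    · rw [mem_closedBall, dist_self_add_left, norm_smul, hc, mul_one, Real.norm_of_nonneg hr0.le]
    · refine hM.isNearestPoint_of_notMem_medialAxis hp (hnorm_p c) hc hr0
        fun t ht htr => hmed _ ?_
      rw [mem_ball, dist_self_add_left, norm_smul, hc, mul_one, Real.norm_of_nonneg ht.le]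
      exact htr
  obtain ⟨hB1, hN1⟩ := near l (l • W q) (D - b) rfl hln rfl rfl hs
  obtain ⟨hB2, hN2⟩ := near (-l) ((-l) • W q) (D + b) rfl hln' (by rw [hbneg]; ring)
    (by rw [hbneg]; ring) hs'
  obtain ⟨hBp, hNp⟩ := nearp k hkn
  obtain ⟨hBp', hNp'⟩ := nearp (-k) hkn'
  have I1 := hM.add_le_dist_of_opposite hr0 hr hW hq hqr hp hpr hs hr0 hln hkn'
    (by nlinarith [mul_pos hk hl]) hN1 hNp' hB1 hBp'
  have I2 := hM.add_le_dist_of_opposite hr0 hr hW hq hqr hp hpr hs' hr0 hln' hkn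
    (by nlinarith [mul_pos hk hl]) hN2 hNp hB2 hBp
  set n := k • W p with hn
  set m := l • W q with hm
  set C := ⟪n, m⟫ with hC
  have hC1 : C ≤ 1 := by
    have := real_inner_le_norm n m
    rwa [hkn, hln, mul_one] at this
  set g := ⟪n, q - p⟫ with hg
  have J1 : ((D - b) + r) ^ 2 ≤ 2 * r ^ 2 + 2 * r * (g + (D - b) * C) := by
    refine (pow_le_pow_left₀ (by positivity) I1 2).trans_eq ?_
    have e : q + (D - b) • m - (p + r • (-k) • W p) = (q + (D - b) • m - p) + r • n := by
      rw [hn]; module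
    have e2 : ⟪q + (D - b) • m - p, n⟫ = g + (D - b) * C := by
      rw [show q + (D - b) • m - p = (q - p) + (D - b) • m by abel, inner_add_left,
        inner_smul_left, real_inner_comm n, real_inner_comm n m]
      rfl
    rw [dist_eq_norm, e, norm_add_sq_real, ← dist_eq_norm, hdist _ m hln, norm_smul, hkn,
      inner_smul_right, e2, ← hb, mul_one, Real.norm_of_nonneg hr0.le]
    linear_combination hD2 + hh2
  have J2 : ((D + b) + r) ^ 2 ≤ 2 * r ^ 2 - 2 * r * (g - (D + b) * C) := by
    refine (pow_le_pow_left₀ (by positivity) I2 2).trans_eq ?_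
    have e2 : ⟪q + (D + b) • (-l) • W q - p, n⟫ = g - (D + b) * C := by
      rw [show q + (D + b) • (-l) • W q - p = (q - p) - (D + b) • m by rw [hm]; module,
        inner_sub_left, inner_smul_left, real_inner_comm n, real_inner_comm n m]
      rfl
    have e : q + (D + b) • (-l) • W q - (p + r • n) = (q + (D + b) • (-l) • W q - p) - r • n := by
      module
    rw [dist_eq_norm, e, norm_sub_sq_real, ← dist_eq_norm, hdist _ _ hln', norm_smul, hkn,
      inner_smul_right, e2, hbneg, mul_one, Real.norm_of_nonneg hr0.le]
    linear_combination hD2 + hh2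
  refine le_trans (le_of_eq ?_) (cos_bound_of_tangent_balls hr0 hh0 hD2 hD0 hC1 J1 J2)
  have hsq : Real.sqrt (1 - (ℓ / r) ^ 2) = h / r := by
    rw [show 1 - (ℓ / r) ^ 2 = (h / r) ^ 2 by rw [div_pow, div_pow, hh2]; field_simp,
      Real.sqrt_sq (by positivity)]
  rw [hsq, hh2]
  field_simp
  ring

/-! ### Continuous choice of normals over a ball -/

/-- The orthogonal projection to the line spanned by a unit vector. -/
noncomputable def lineProj (u : E3) : E3 →L[ℝ] E3 := (innerSL ℝ u).smulRight u

theorem lineProj_apply (u v : E3) : lineProj u v = ⟪u, v⟫ • u := rfl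

theorem lineProj_smul (c : ℝ) (u : E3) : lineProj (c • u) = c ^ 2 • lineProj u := by
  ext1 v
  simp only [lineProj_apply, smul_apply, inner_smul_left, conj_trivial,
    smul_smul]
  congr 1
  ring

theorem lineProj_idem {u : E3} (hu : ‖u‖ = 1) (v : E3) :
    lineProj u (lineProj u v) = lineProj u v := by
  simp [lineProj_apply, hu]

theorem continuous_lineProj : Continuous lineProj := by
  have h1 : Continuous fun u : E3 =>
      ContinuousLinearMap.smulRightL ℝ E3 E3 (innerSL ℝ u) u := by fun_prop
  exact h1

namespace IsClosedSurface

variable {M : Set E3}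

/-- The projections to the normal lines of `M` depend continuously on the foot point. -/
theorem continuousOn_lineProj (hM : IsClosedSurface M) {u : E3 → E3}
    (hu : ∀ y ∈ M, IsNormalVector M y (u y)) (hu1 : ∀ y ∈ M, ‖u y‖ = 1) :
    ContinuousOn (fun y => lineProj (u y)) M := by
  intro y hy
  obtain ⟨f, hf⟩ := hM.exists_defining y hy
  have hev : ∀ᶠ z in 𝓝[M] y,
      lineProj (u z) = (‖gradient f z‖ ^ 2)⁻¹ • lineProj (gradient f z) := by
    filter_upwards [self_mem_nhdsWithin, nhdsWithin_le_nhds hf.eventually] with z hz hfz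
    obtain ⟨c, hc⟩ := hfz.exists_eq_smul_gradient_of_isNormalVector hz (hu z hz)
    have h1 := hu1 z hz
    rw [hc, norm_smul, Real.norm_eq_abs] at h1
    have h2 : c ^ 2 * ‖gradient f z‖ ^ 2 = 1 := by rw [← sq_abs, ← mul_pow, h1, one_pow]
    rw [hc, lineProj_smul, eq_inv_of_mul_eq_one_left h2]
  refine ContinuousWithinAt.congr_of_eventuallyEq ?_ hev (hev.self_of_nhdsWithin hy)
  have hg := hf.continuousAt_gradient
  have h0 : ‖gradient f y‖ ^ 2 ≠ 0 := pow_ne_zero 2 (norm_ne_zero_iff.2 hf.gradient_ne_zero)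
  have hl : ContinuousAt (fun z => lineProj (gradient f z)) y :=
    continuous_lineProj.continuousAt.comp hg
  exact (((hg.norm.pow 2).inv₀ h0).smul hl).continuousWithinAt

/-- Over a closed ball about `p` that misses the medial axis, normals at the nearest points can be
chosen continuously. -/
theorem exists_isNormalLift (hM : IsClosedSurface M) {p : E3} (hp : p ∈ M) {r : ℝ}
    (hr : r < lfs M p) : ∃ W, IsNormalLift M (closedBall p r) W := by
  have hne : M.Nonempty := ⟨p, hp⟩
  choose! u hu hu1 using fun y (hy : y ∈ M) => hM.exists_unit_normal hy
  set Q : E3 → E3 →L[ℝ] E3 := fun x => lineProj (u (proj M x)) with hQ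
  have hpm : ∀ x, proj M x ∈ M := fun x => (isNearestPoint_proj hM.isCompact hne x).1
  have hQc : ContinuousOn Q (closedBall p r) := by
    refine (hM.continuousOn_lineProj hu hu1).comp (fun x hx => ?_) fun x _ => hpm x
    exact (continuousAt_proj hM.isCompact hne (notMem_medialAxis_of_dist_lt_lfs
      (by rw [dist_comm]; exact (mem_closedBall.1 hx).trans_lt hr))).continuousWithinAt
  obtain ⟨η, hη, hunif⟩ := Metric.uniformContinuousOn_iff.1
    ((isCompact_closedBall p r).uniformContinuousOn_of_continuous hQc) 1 one_pos
  obtain ⟨N, hN⟩ := exists_nat_gt (max (r / η) 0)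
  have hN0 : (0 : ℝ) < N := (le_max_right _ _).trans_lt hN
  have hrN : r / N < η := by
    have := (le_max_left _ _).trans_lt hN
    rw [div_lt_iff₀ hη] at this
    rw [div_lt_iff₀ hN0]
    linarith
  have hin : ∀ x ∈ closedBall p r, ∀ k ≤ N, p + ((k : ℝ) / N) • (x - p) ∈ closedBall p r := by
    intro x hx k hk
    have hk1 : (k : ℝ) / N ≤ 1 := (div_le_one hN0).2 (by exact_mod_cast hk)
    have hp' : p ∈ closedBall p r := mem_closedBall_self (dist_nonneg.trans (mem_closedBall.1 hx))
    exact (convex_closedBall p r).add_smul_sub_mem hp' hx ⟨by positivity, hk1⟩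
  -- Transport the normal at `p` along each radius in `N` steps, projecting onto the next normal
  -- line. Consecutive projections differ by less than 1 in operator norm, so a nonzero vector fixed
  -- by one is not killed by the next.
  have main : ∀ k ≤ N, ∃ W : E3 → E3, ContinuousOn W (closedBall p r) ∧
      ∀ x ∈ closedBall p r, W x ≠ 0 ∧ Q (p + ((k : ℝ) / N) • (x - p)) (W x) = W x := by
    intro k
    induction k with
    | zero =>
      refine fun _ => ⟨fun _ => u p, continuousOn_const, fun x _ => ⟨?_, ?_⟩⟩
      · exact norm_ne_zero_iff.1 (by rw [hu1 p hp]; norm_num)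
      · have : proj M p = p := proj_eq (hM.notMem_medialAxis hp) (isNearestPoint_self hp)
        simp [hQ, this, lineProj_apply, hu1 p hp]
    | succ k ih =>
      intro hk
      obtain ⟨W, hWc, hW⟩ := ih (by omega)
      refine ⟨fun x => Q (p + (((k + 1 : ℕ) : ℝ) / N) • (x - p)) (W x), ?_, fun x hx => ⟨?_, ?_⟩⟩
      · refine ContinuousOn.clm_apply ?_ hWc
        exact hQc.comp (by fun_prop) fun x hx => hin x hx _ hk
      · intro (h0 : Q (p + (((k + 1 : ℕ) : ℝ) / N) • (x - p)) (W x) = 0)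
        obtain ⟨hWx, hfix⟩ := hW x hx
        have hd := hunif _ (hin x hx (k + 1) hk) _ (hin x hx k (by omega)) (by
          rw [dist_add_left, dist_eq_norm, ← sub_smul, norm_smul, ← sub_div]
          push_cast
          rw [add_sub_cancel_left, Real.norm_of_nonneg (by positivity), ← dist_eq_norm,
            one_div_mul_eq_div]
          exact (div_le_div_of_nonneg_right (mem_closedBall.1 hx) hN0.le).trans_lt hrN)
        rw [dist_eq_norm] at hd
        have h1 := ContinuousLinearMap.le_opNorm (Q (p + (((k + 1 : ℕ) : ℝ) / N) • (x - p)) -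
          Q (p + ((k : ℝ) / N) • (x - p))) (W x)
        rw [sub_apply, hfix, h0, zero_sub, norm_neg] at h1
        have h2 : 0 < ‖W x‖ := norm_pos_iff.2 hWx
        nlinarith
      · exact lineProj_idem (hu1 _ (hpm _)) _
  obtain ⟨W, hWc, hW⟩ := main N le_rfl
  refine ⟨W, hWc, fun x hx => (hW x hx).1, fun x hx => ?_⟩
  have := (hW x hx).2
  rw [div_self hN0.ne', one_smul, add_sub_cancel] at this
  rw [← this]
  exact (hu _ (hpm x)).smul _

theorem eq_or_eq_neg_of_isNormalVector {p n m : E3} (hp : p ∈ M) (hn : IsNormalVector M p n)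
    (hm : IsNormalVector M p m) (hn1 : ‖n‖ = 1) (hm1 : ‖m‖ = 1) : m = n ∨ m = -n := by
  obtain ⟨c, rfl⟩ := hn.exists_eq_smul hp (norm_ne_zero_iff.1 (by rw [hn1]; norm_num)) hm
  rw [norm_smul, hn1, mul_one, Real.norm_eq_abs] at hm1
  rcases eq_or_eq_neg_of_abs_eq hm1 with rfl | rfl
  · exact Or.inl (one_smul _ _)
  · exact Or.inr (by rw [neg_smul, one_smul])

/-- Normal variation, for the normals as unoriented directions. -/
theorem le_abs_inner_normal (hM : IsClosedSurface M) {p q n m : E3} (hp : p ∈ M) (hq : q ∈ M)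
    (hpq : dist p q < lfs M p) (hn : IsNormalVector M p n) (hm : IsNormalVector M q m)
    (hn1 : ‖n‖ = 1) (hm1 : ‖m‖ = 1) :
    1 - (dist p q / lfs M p) ^ 2 / (2 * Real.sqrt (1 - (dist p q / lfs M p) ^ 2)) ≤ |⟪n, m⟫| := by
  set ℓ := dist p q with hℓ
  have hℓ0 : 0 ≤ ℓ := dist_nonneg
  set R := lfs M p with hR
  have hR0 : 0 < R := hM.lfs_pos hp
  -- The lift exists only for radii below `lfs M p`, by a compactness argument; continuity of the
  -- bound in the radius then gives the limit value.
  have hcont : ContinuousAt (fun r : ℝ => 1 - (ℓ / r) ^ 2 / (2 * Real.sqrt (1 - (ℓ / r) ^ 2))) R := by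
    have h1 : ContinuousAt (fun r : ℝ => ℓ / r) R := continuousAt_const.div continuousAt_id hR0.ne'
    have h2 : ℓ / R < 1 := (div_lt_one hR0).2 hpq
    have h3 : 0 < 1 - (ℓ / R) ^ 2 := by nlinarith [div_nonneg hℓ0 hR0.le]
    have h4 : 2 * Real.sqrt (1 - (ℓ / R) ^ 2) ≠ 0 := by
      have := Real.sqrt_pos.2 h3
      positivity
    exact continuousAt_const.sub ((h1.pow 2).div
      (continuousAt_const.mul (continuousAt_const.sub (h1.pow 2)).sqrt) h4)
  refine le_of_tendsto (hcont.tendsto.mono_left (nhdsWithin_le_nhds (s := Iio R))) ?_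
  filter_upwards [self_mem_nhdsWithin, nhdsWithin_le_nhds (lt_mem_nhds hpq)] with r hrR hℓr
  have hr0 : 0 < r := hℓ0.trans_lt hℓr
  obtain ⟨W, hWcl⟩ := hM.exists_isNormalLift hp (r := r) hrR
  have hW : IsNormalLift M (ball p r) W :=
    ⟨hWcl.continuousOn.mono ball_subset_closedBall,
      fun x hx => hWcl.ne_zero x (ball_subset_closedBall hx),
      fun x hx => hWcl.isNormal x (ball_subset_closedBall hx)⟩
  have hpr : p ∈ ball p r := mem_ball_self hr0
  have hqr : q ∈ ball p r := by rw [mem_ball, dist_comm]; exact hℓr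
  have hprojM : ∀ {y}, y ∈ M → proj M y = y := fun {y} hy =>
    proj_eq (hM.notMem_medialAxis hy) (isNearestPoint_self hy)
  have hWp := hW.isNormal p hpr
  have hWq := hW.isNormal q hqr
  rw [hprojM hp] at hWp
  rw [hprojM hq] at hWq
  have hkn : ‖‖W p‖⁻¹ • W p‖ = 1 := norm_smul_inv_norm (𝕜 := ℝ) (hW.ne_zero p hpr)
  have hln : ‖‖W q‖⁻¹ • W q‖ = 1 := norm_smul_inv_norm (𝕜 := ℝ) (hW.ne_zero q hqr)
  refine (hM.le_inner_normal_of_isNormalLift hp hq hr0 (le_of_lt hrR) hℓr hW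
    (inv_pos.2 (norm_pos_iff.2 (hW.ne_zero p hpr))) (inv_pos.2 (norm_pos_iff.2 (hW.ne_zero q hqr)))
    hkn hln).trans ?_
  refine (le_abs_self _).trans (le_of_eq ?_)
  rcases eq_or_eq_neg_of_isNormalVector hp hn (hWp.smul _) hn1 hkn with h | h <;>
  rcases eq_or_eq_neg_of_isNormalVector hq hm (hWq.smul _) hm1 hln with h' | h' <;>
  rw [h, h'] <;> simp

/-- Normal variation, for a continuous unit normal field. -/
theorem le_inner_unitNormalField (hM : IsClosedSurface M) {p q : E3} (hp : p ∈ M) (hq : q ∈ M)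
    (hpq : dist p q < lfs M p) {ν : E3 → E3} (hν : IsUnitNormalField M ν) :
    1 - (dist p q / lfs M p) ^ 2 / (2 * Real.sqrt (1 - (dist p q / lfs M p) ^ 2)) ≤
      ⟪ν p, ν q⟫ := by
  have hne : M.Nonempty := ⟨p, hp⟩
  have hpm : ∀ x, proj M x ∈ M := fun x => (isNearestPoint_proj hM.isCompact hne x).1
  have hprojM : ∀ {y}, y ∈ M → proj M y = y := fun {y} hy =>
    proj_eq (hM.notMem_medialAxis hy) (isNearestPoint_self hy)
  have hW : IsNormalLift M (ball p (lfs M p)) (fun x => ν (proj M x)) := by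
    refine ⟨hν.continuousOn.comp (fun x hx => ?_) fun x _ => hpm x, fun x _ => ?_,
      fun x _ => hν.isNormal _ (hpm x)⟩
    · exact (continuousAt_proj hM.isCompact hne (notMem_medialAxis_of_dist_lt_lfs
        (by rw [dist_comm]; exact hx))).continuousWithinAt
    · exact norm_ne_zero_iff.1 (by rw [hν.norm_eq_one _ (hpm x)]; norm_num)
  have h := hM.le_inner_normal_of_isNormalLift hp hq (hM.lfs_pos hp) le_rfl hpq hW one_pos one_pos
  simp only [one_smul, hprojM hp, hprojM hq] at h
  exact h (hν.norm_eq_one p hp) (hν.norm_eq_one q hq)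

end IsClosedSurface

/-! ### Adding up the angles -/

theorem lineAngle_neg_left (x y : E3) : lineAngle (-x) y = lineAngle x y := by
  simp [lineAngle]

theorem lineAngle_neg_right (x y : E3) : lineAngle x (-y) = lineAngle x y := by
  simp [lineAngle]

theorem lineAngle_le_angle (x y : E3) : lineAngle x y ≤ InnerProductGeometry.angle x y :=
  Real.antitone_arccos (div_le_div_of_nonneg_right (le_abs_self _) (by positivity))

theorem angle_eq_lineAngle {x y : E3} (h : 0 ≤ ⟪x, y⟫) :
    InnerProductGeometry.angle x y = lineAngle x y := by
  rw [lineAngle, abs_of_nonneg h]; rfl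

theorem IsFaceNormal.neg {T : Affine.Triangle ℝ E3} {N : E3} (hN : IsFaceNormal T N) :
    IsFaceNormal T (-N) :=
  ⟨neg_ne_zero.2 hN.1, fun w hw => by rw [inner_neg_right, hN.2 w hw, neg_zero]⟩

/-- Face normals directed consistently with surface normals make at most the angle between the
surface normals plus the two face terms. -/
theorem IsClosedSurface.angle_faceNormal_le {M : Set E3} (hM : IsClosedSurface M)
    {T₁ T₂ : Affine.Triangle ℝ E3} (hT₁ : ∀ i, T₁.points i ∈ M) (hT₂ : ∀ i, T₂.points i ∈ M)
    (i₁ i₂ : Fin 3) {N₁ N₂ n₁ n₂ : E3} (hN₁ : IsFaceNormal T₁ N₁) (hN₂ : IsFaceNormal T₂ N₂)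
    (hn₁ : IsNormalVector M (T₁.points i₁) n₁) (hn₂ : IsNormalVector M (T₂.points i₂) n₂)
    (h₁ : ‖n₁‖ = 1) (h₂ : ‖n₂‖ = 1) (hd₁ : 0 ≤ ⟪N₁, n₁⟫) (hd₂ : 0 ≤ ⟪N₂, n₂⟫) {c : ℝ}
    (hc : c ≤ ⟪n₁, n₂⟫) :
    InnerProductGeometry.angle N₁ N₂ ≤ Real.arccos c + faceTerm M T₁ i₁ + faceTerm M T₂ i₂ := by
  have e1 := hM.lineAngle_le_faceTerm hT₁ i₁ hN₁ hn₁ h₁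
  have e2 := hM.lineAngle_le_faceTerm hT₂ i₂ hN₂ hn₂ h₂
  rw [← angle_eq_lineAngle hd₁] at e1
  rw [← angle_eq_lineAngle hd₂, InnerProductGeometry.angle_comm] at e2
  have e3 : InnerProductGeometry.angle n₁ n₂ ≤ Real.arccos c := by
    rw [InnerProductGeometry.angle, h₁, h₂, mul_one, div_one]
    exact Real.antitone_arccos hc
  have t1 := InnerProductGeometry.angle_le_angle_add_angle N₁ n₁ N₂
  have t2 := InnerProductGeometry.angle_le_angle_add_angle n₁ n₂ N₂
  linarith

theorem exists_sign_inner_nonneg (x y : E3) : ∃ z, (z = x ∨ z = -x) ∧ 0 ≤ ⟪z, y⟫ := by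
  rcases le_total 0 ⟪x, y⟫ with h | h
  · exact ⟨x, Or.inl rfl, h⟩
  · exact ⟨-x, Or.inr rfl, by rw [inner_neg_left]; linarith⟩

/-- At this threshold for δ the cosine bound equals -1. What the argument takes from it is δ < 1,
which puts the second vertex in the ball of radius `lfs` about the first. -/
theorem sqrt_four_mul_sqrt_five_sub_eight_lt_one : Real.sqrt (4 * Real.sqrt 5 - 8) < 1 := by
  have h : Real.sqrt 5 < 9 / 4 := by
    rw [Real.sqrt_lt' (by norm_num)]
    norm_num
  rw [Real.sqrt_lt' one_pos]
  linarith

end AngleBound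

open AngleBound in
theorem mainTheorem3 (M : Set AngleBound.E3) (hM : AngleBound.IsClosedSurface M)
    (T₁ T₂ : Affine.Triangle ℝ AngleBound.E3)
    (hT₁ : ∀ i, T₁.points i ∈ M) (hT₂ : ∀ i, T₂.points i ∈ M)
    (i₁ i₂ : Fin 3) (δ : ℝ)
    (hδ : δ = dist (T₁.points i₁) (T₂.points i₂) / AngleBound.lfs M (T₁.points i₁))
    (hδ_lt : δ < Real.sqrt (4 * Real.sqrt 5 - 8))
    (N₁ N₂ : AngleBound.E3)
    (hN₁ : AngleBound.IsFaceNormal T₁ N₁) (hN₂ : AngleBound.IsFaceNormal T₂ N₂) :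
    -- the angle between the face normals as unoriented directions
    AngleBound.lineAngle N₁ N₂ ≤
        Real.arccos (1 - δ ^ 2 / (2 * Real.sqrt (1 - δ ^ 2)))
          + AngleBound.faceTerm M T₁ i₁ + AngleBound.faceTerm M T₂ i₂ ∧
    -- the angle between the face normals as vectors, directed to the same side of the surface
    ∀ ν : AngleBound.E3 → AngleBound.E3, AngleBound.IsUnitNormalField M ν →
      0 ≤ ⟪N₁, ν (T₁.points i₁)⟫ → 0 ≤ ⟪N₂, ν (T₂.points i₂)⟫ →
      InnerProductGeometry.angle N₁ N₂ ≤
        Real.arccos (1 - δ ^ 2 / (2 * Real.sqrt (1 - δ ^ 2)))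
          + AngleBound.faceTerm M T₁ i₁ + AngleBound.faceTerm M T₂ i₂ := by
  have hp := hT₁ i₁
  have hq := hT₂ i₂
  have hlt : dist (T₁.points i₁) (T₂.points i₂) < lfs M (T₁.points i₁) := by
    rw [← div_lt_one (hM.lfs_pos hp), ← hδ]
    exact hδ_lt.trans sqrt_four_mul_sqrt_five_sub_eight_lt_one
  constructor
  · obtain ⟨n, hn, hn1⟩ := hM.exists_unit_normal hp
    obtain ⟨m, hm, hm1⟩ := hM.exists_unit_normal hq
    have hv := hM.le_abs_inner_normal hp hq hlt hn hm hn1 hm1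
    rw [← hδ] at hv
    -- Line angles ignore signs, so the second surface normal, and then both face normals, may be
    -- reoriented to reduce to the directed estimate.
    obtain ⟨m', hm', hm'1, hv'⟩ : ∃ m', IsNormalVector M (T₂.points i₂) m' ∧ ‖m'‖ = 1 ∧
        1 - δ ^ 2 / (2 * Real.sqrt (1 - δ ^ 2)) ≤ ⟪n, m'⟫ := by
      rcases abs_cases ⟪n, m⟫ with ⟨h, -⟩ | ⟨h, -⟩
      · exact ⟨m, hm, hm1, h ▸ hv⟩
      · exact ⟨-m, by simpa using hm.smul (-1), by rw [norm_neg, hm1], by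
          rw [inner_neg_right, ← h]; exact hv⟩
    obtain ⟨N, hN, hNn⟩ := exists_sign_inner_nonneg N₁ n
    obtain ⟨N', hN', hNn'⟩ := exists_sign_inner_nonneg N₂ m'
    have hF : IsFaceNormal T₁ N := by rcases hN with rfl | rfl; exacts [hN₁, hN₁.neg]
    have hF' : IsFaceNormal T₂ N' := by rcases hN' with rfl | rfl; exacts [hN₂, hN₂.neg]
    have hline : lineAngle N₁ N₂ = lineAngle N N' := by
      rcases hN with rfl | rfl <;> rcases hN' with rfl | rfl <;>
        simp only [lineAngle_neg_left, lineAngle_neg_right]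
    rw [hline]
    exact (lineAngle_le_angle N N').trans
      (hM.angle_faceNormal_le hT₁ hT₂ i₁ i₂ hF hF' hn hm' hn1 hm'1 hNn hNn' hv')
  · intro ν hν hd₁ hd₂
    have hv := hM.le_inner_unitNormalField hp hq hlt hν
    rw [← hδ] at hv
    exact hM.angle_faceNormal_le hT₁ hT₂ i₁ i₂ hN₁ hN₂ (hν.isNormal _ hp) (hν.isNormal _ hq)
      (hν.norm_eq_one _ hp) (hν.norm_eq_one _ hq) hd₁ hd₂ hv
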